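/- Let $n\ge 3$. Put $\delta_0=1$ and $\delta_k(x)=1-x_k\,\delta_{k-1}(x)$ for $1\le k\le n$, and for $p=(a_1,\dots,a_n,b_1,\dots,b_n,c_2,\dots,c_n)\in\mathbb Z^{3n-1}$ let $$L(p)=\int_{[0,1]^n}\frac{\prod_{k=1}^n x_k^{a_k}(1-x_k)^{b_k}}{\prod_{k=2}^n\delta_k(x)^{c_k}}\,\frac{dx_1\cdots dx_n}{\delta_n(x)}\in[0,\infty].$$ Consider the following automorphisms of $\mathbb Z^{3n-1}$: $\sigma$ exchanges $a_1$ with $b_2$ and $a_2$ with $b_1$; $\chi$ exchanges $a_n$ with $c_n$ and replaces $b_n$ by $a_n+b_n-c_n$ (both fix all other coordinates); $\psi$ maps $p$ to $p'=(a'_k,b'_k,c'_k)$ with $a'_k=a_{n+1-k}$ $(1\le k\le n)$, $b'_1=a_{n-1}+b_n-c_n$, $b'_k=b_{n+2-k}$ $(2\le k\le n)$, $c'_k=a_{n+2-k}+b_{n+2-k}+c_{n+1-k}-b_{n+1-k}-a_{n-k}$ $(2\le k\le n-1)$, $c'_n=a_2+b_2-b_1$. Let $G\subset \mathrm{GL}_{3n-1}(\mathbb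 Z)$ be the group generated by $\sigma,\psi,\chi$. Then $L(p)>0$ and $L(p)=L(\sigma(p))=L(\psi(p))$ for all $p\in\mathbb Z^{3n-1}$, and $$L(p)=\frac{a_n!\,b_n!}{c_n!\,(a_n+b_n-c_n)!}\,L(\chi(p))$$ for all $p$ such that $a_n,b_n,c_n,a_n+b_n-c_n\ge 0$ (infinite values allowed in these identities). The group $G$ has order $32$ and is isomorphic to $(V\times V)\rtimes\mathbb Z/2\mathbb Z$, where $V=\mathbb Z/2\mathbb Z\times\mathbb Z/2\mathbb Z$ and $\mathbb Z/2\mathbb Z$ permutes the two factors. Moreover $G$ is a Rhin–Viola group of the family $(L(p))$, in the following sense. For all $g\in G$ and $p\in\mathbb Z^{3n-1}$ such that $L(p)$ and $L(g(p))$ are both finite, $L(g(p))/L(p)$ is a nonzero rational number. Further, let $E$ be the set of $p$ for which the eight integers $$a_n,\ b_n,\ c_n,\ a_n+b_n-c_n,\ a_1,\ b_2,\ a_2+b_2-b_1,\ a_1+b_1-a_2$$ are nonnegative. Then $E$ is stable under $G$ and, for all $g\in G$ and $p\in E$, the quotient $L(g(p))/L(p)$ is a nonzero rational number, with the convention $\infty/\infty=1$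 (so that $L(g(p))$ is infinite if and only if $L(p)$ is). -/

import Mathlib

open MeasureTheory
open scoped ENNReal

namespace RhinViola

/-! ### Families of positive numbers and their Rhin–Viola groups -/

/-- The quotient `x / y` is a nonzero rational number, with the convention `∞ / ∞ = 1`
(and no other quotient involving `∞` is rational). -/
def RationalRatio (x y : ℝ≥0∞) : Prop :=
  (x = ∞ ∧ y = ∞) ∨ (x ≠ ∞ ∧ y ≠ ∞ ∧ ∃ q : ℚ, q ≠ 0 ∧ x.toReal / y.toReal = (q : ℝ))

/-- The group `GL_s(ℤ)` of automorphisms of `ℤ^s`, the coordinates being indexed by `ι`. -/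
abbrev GLZ (ι : Type) : Type := (ι → ℤ) ≃ₗ[ℤ] (ι → ℤ)

/-- The subgroup `G` of `GL_s(ℤ)` is a Rhin–Viola group of the family `(I p)`, for `p` in the
`G`-stable set `E` of parameters, the values of the family being in `ℝ_{>0} ∪ {∞}`. -/
def IsRhinViolaGroup {ι : Type} (I : (ι → ℤ) → ℝ≥0∞) (E : Set (ι → ℤ))
    (G : Subgroup (GLZ ι)) : Prop :=
  (∀ p ∈ E, 0 < I p) ∧ (∀ g ∈ G, ∀ p ∈ E, g p ∈ E) ∧
    ∀ g ∈ G, ∀ p ∈ E, RationalRatio (I (g p)) (I p)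

/-! ### Parameters `(a_1, …, a_n, b_1, …, b_n, c_2, …, c_n)` -/

/-- Index set of the `3n - 1` coordinates. -/
abbrev Index (n : ℕ) : Type := Fin n ⊕ Fin n ⊕ Fin (n - 1)

/-- `ℤ^{3n-1}`. -/
abbrev Params (n : ℕ) : Type := Index n → ℤ

/-- The coordinate `a_k` (for `1 ≤ k ≤ n`). -/
def cA {n : ℕ} (p : Params n) (k : ℕ) : ℤ :=
  if h : 1 ≤ k ∧ k ≤ n then p (Sum.inl ⟨k - 1, by omega⟩) else 0

/-- The coordinate `b_k` (for `1 ≤ k ≤ n`). -/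
def cB {n : ℕ} (p : Params n) (k : ℕ) : ℤ :=
  if h : 1 ≤ k ∧ k ≤ n then p (Sum.inr (Sum.inl ⟨k - 1, by omega⟩)) else 0

/-- The coordinate `c_k` (for `2 ≤ k ≤ n`). -/
def cC {n : ℕ} (p : Params n) (k : ℕ) : ℤ :=
  if h : 2 ≤ k ∧ k ≤ n then p (Sum.inr (Sum.inr ⟨k - 2, by omega⟩)) else 0

/-- The vector with coordinates `a_k = a k`, `b_k = b k` (`1 ≤ k ≤ n`), `c_k = c k`
(`2 ≤ k ≤ n`). -/
def ofCoords (n : ℕ) (a b c : ℕ → ℤ) : Params n :=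
  Sum.elim (fun i => a (i + 1)) (Sum.elim (fun i => b (i + 1)) (fun i => c (i + 2)))

lemma cA_ofCoords {n : ℕ} (a b c : ℕ → ℤ) (k : ℕ) :
    cA (ofCoords n a b c) k = if 1 ≤ k ∧ k ≤ n then a k else 0 := by
  unfold cA ofCoords
  split_ifs with h
  · simp [Nat.sub_add_cancel h.1]
  · rfl

lemma cB_ofCoords {n : ℕ} (a b c : ℕ → ℤ) (k : ℕ) :
    cB (ofCoords n a b c) k = if 1 ≤ k ∧ k ≤ n then b k else 0 := by
  unfold cB ofCoords
  split_ifs with h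
  · simp [Nat.sub_add_cancel h.1]
  · rfl

lemma cC_ofCoords {n : ℕ} (a b c : ℕ → ℤ) (k : ℕ) :
    cC (ofCoords n a b c) k = if 2 ≤ k ∧ k ≤ n then c k else 0 := by
  unfold cC ofCoords
  split_ifs with h
  · simp [Nat.sub_add_cancel h.1]
  · rfl

lemma params_ext {n : ℕ} {p q : Params n}
    (ha : ∀ k, 1 ≤ k → k ≤ n → cA p k = cA q k) (hb : ∀ k, 1 ≤ k → k ≤ n → cB p k = cB q k)
    (hc : ∀ k, 2 ≤ k → k ≤ n → cC p k = cC q k) : p = q := by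
  funext i
  rcases i with i | i | i
  · have hi := i.isLt
    have h1 : 1 ≤ i.val + 1 ∧ i.val + 1 ≤ n := by omega
    have h := ha (i.val + 1) h1.1 h1.2
    simpa [cA, h1.2] using h
  · have hi := i.isLt
    have h1 : 1 ≤ i.val + 1 ∧ i.val + 1 ≤ n := by omega
    have h := hb (i.val + 1) h1.1 h1.2
    simpa [cB, h1.2] using h
  · have hi := i.isLt
    have h1 : 2 ≤ i.val + 2 ∧ i.val + 2 ≤ n := by omega
    have h := hc (i.val + 2) h1.1 h1.2
    simpa [cC, h1.2] using h

lemma cA_add {n : ℕ} (p q : Params n) (k : ℕ) : cA (p + q) k = cA p k + cA q k := by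
  unfold cA; split_ifs <;> simp

lemma cB_add {n : ℕ} (p q : Params n) (k : ℕ) : cB (p + q) k = cB p k + cB q k := by
  unfold cB; split_ifs <;> simp

lemma cC_add {n : ℕ} (p q : Params n) (k : ℕ) : cC (p + q) k = cC p k + cC q k := by
  unfold cC; split_ifs <;> simp

lemma cA_smul {n : ℕ} (m : ℤ) (p : Params n) (k : ℕ) : cA (m • p) k = m * cA p k := by
  unfold cA; split_ifs <;> simp

lemma cB_smul {n : ℕ} (m : ℤ) (p : Params n) (k : ℕ) : cB (m • p) k = m * cB p k := by
  unfold cB; split_ifs <;> simp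

lemma cC_smul {n : ℕ} (m : ℤ) (p : Params n) (k : ℕ) : cC (m • p) k = m * cC p k := by
  unfold cC; split_ifs <;> simp

/-! ### The automorphisms `σ`, `ψ`, `χ` -/

/-- `σ` exchanges `a_1` with `b_2` and `a_2` with `b_1`. -/
def sigmaFun (n : ℕ) (p : Params n) : Params n :=
  ofCoords n
    (fun k => if k = 1 then cB p 2 else if k = 2 then cB p 1 else cA p k)
    (fun k => if k = 1 then cA p 2 else if k = 2 then cA p 1 else cB p k)
    (fun k => cC p k)

/-- `ψ`. -/
def psiFun (n : ℕ) (p : Params n) : Params n :=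
  ofCoords n
    (fun k => cA p (n + 1 - k))
    (fun k => if k = 1 then cA p (n - 1) + cB p n - cC p n else cB p (n + 2 - k))
    (fun k => if k = n then cA p 2 + cB p 2 - cB p 1 else
      cA p (n + 2 - k) + cB p (n + 2 - k) + cC p (n + 1 - k) - cB p (n + 1 - k) - cA p (n - k))

/-- `χ` exchanges `a_n` with `c_n` and replaces `b_n` by `a_n + b_n - c_n`. -/
def chiFun (n : ℕ) (p : Params n) : Params n :=
  ofCoords n
    (fun k => if k = n then cC p n else cA p k)
    (fun k => if k = n then cA p n + cB p n - cC p n else cB p k)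
    (fun k => if k = n then cA p n else cC p k)

/-- `σ` as an automorphism of `ℤ^{3n-1}`. -/
def sigma (n : ℕ) (hn : 2 ≤ n) : GLZ (Index n) :=
  LinearEquiv.ofInvolutive
    { toFun := sigmaFun n
      map_add' := fun p q => by
        apply params_ext <;> intro k h1 h2 <;>
          simp only [sigmaFun, cA_ofCoords, cB_ofCoords, cC_ofCoords, cA_add, cB_add, cC_add] <;>
          grind
      map_smul' := fun m p => by
        apply params_ext <;> intro k h1 h2 <;>
          simp only [sigmaFun, cA_ofCoords, cB_ofCoords, cC_ofCoords, cA_smul, cB_smul, cC_smul,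
            RingHom.id_apply] <;>
          grind }
    (fun p => by
      change sigmaFun n (sigmaFun n p) = p
      apply params_ext <;> intro k h1 h2 <;>
        simp only [sigmaFun, cA_ofCoords, cB_ofCoords, cC_ofCoords] <;> grind)

/-- `ψ` as an automorphism of `ℤ^{3n-1}`. -/
def psi (n : ℕ) (hn : 2 ≤ n) : GLZ (Index n) :=
  LinearEquiv.ofInvolutive
    { toFun := psiFun n
      map_add' := fun p q => by
        apply params_ext <;> intro k h1 h2 <;>
          simp only [psiFun, cA_ofCoords, cB_ofCoords, cC_ofCoords, cA_add, cB_add, cC_add] <;>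
          grind
      map_smul' := fun m p => by
        apply params_ext <;> intro k h1 h2 <;>
          simp only [psiFun, cA_ofCoords, cB_ofCoords, cC_ofCoords, cA_smul, cB_smul, cC_smul,
            RingHom.id_apply] <;>
          grind }
    (fun p => by
      change psiFun n (psiFun n p) = p
      apply params_ext <;> intro k h1 h2 <;>
        simp only [psiFun, cA_ofCoords, cB_ofCoords, cC_ofCoords] <;> grind)

/-- `χ` as an automorphism of `ℤ^{3n-1}`. -/
def chi (n : ℕ) (hn : 2 ≤ n) : GLZ (Index n) :=
  LinearEquiv.ofInvolutive
    { toFun := chiFun n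
      map_add' := fun p q => by
        apply params_ext <;> intro k h1 h2 <;>
          simp only [chiFun, cA_ofCoords, cB_ofCoords, cC_ofCoords, cA_add, cB_add, cC_add] <;>
          grind
      map_smul' := fun m p => by
        apply params_ext <;> intro k h1 h2 <;>
          simp only [chiFun, cA_ofCoords, cB_ofCoords, cC_ofCoords, cA_smul, cB_smul, cC_smul,
            RingHom.id_apply] <;>
          grind }
    (fun p => by
      change chiFun n (chiFun n p) = p
      apply params_ext <;> intro k h1 h2 <;>
        simp only [chiFun, cA_ofCoords, cB_ofCoords, cC_ofCoords] <;> grind)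

/-- The group generated by `σ`, `ψ` and `χ`. -/
def group (n : ℕ) (hn : 2 ≤ n) : Subgroup (GLZ (Index n)) :=
  Subgroup.closure {sigma n hn, psi n hn, chi n hn}

/-! ### The integrals `L(p)` -/

/-- `δ_0 = 1`, `δ_k = 1 - x_k δ_{k-1}`; the variable `x_k` is `x ⟨k - 1, _⟩`. -/
def delta {n : ℕ} (x : Fin n → ℝ) : ℕ → ℝ
  | 0 => 1
  | k + 1 => 1 - (if h : k < n then x ⟨k, h⟩ else 0) * delta x k

/-- The integral `L(p)` over the cube `[0,1]^n`, with values in `[0,∞]` (the integrand is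
nonnegative on the cube). -/
noncomputable def L (n : ℕ) (p : Params n) : ℝ≥0∞ :=
  ∫⁻ x in Set.Icc (0 : Fin n → ℝ) 1,
    ENNReal.ofReal
      ((∏ i : Fin n, x i ^ cA p (i + 1) * (1 - x i) ^ cB p (i + 1)) /
        (∏ k ∈ Finset.Icc 2 n, delta x k ^ cC p k) / delta x n)

/-! ### Domains of parameters -/

/-- The four integers whose factorials occur in the relation between `L(p)` and `L(χ(p))` are
nonnegative. -/
def ChiDomain (n : ℕ) : Set (Params n) :=
  {p | 0 ≤ cA p n ∧ 0 ≤ cB p n ∧ 0 ≤ cC p n ∧ 0 ≤ cA p n + cB p n - cC p n}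

/-- The parameters `p` such that both `p` and `ψ(p)` are in the domain of the relation for `χ`;
the second condition says that `a_1`, `b_2`, `a_2 + b_2 - b_1` and `a_1 + b_1 - a_2` are
nonnegative. -/
def Admissible (n : ℕ) : Set (Params n) :=
  {p | p ∈ ChiDomain n ∧ 0 ≤ cA p 1 ∧ 0 ≤ cB p 2 ∧ 0 ≤ cA p 2 + cB p 2 - cB p 1 ∧
    0 ≤ cA p 1 + cB p 1 - cA p 2}

/-! ### The abstract group `(V × V) ⋊ ℤ/2ℤ` -/

/-- The Klein group `V = ℤ/2ℤ × ℤ/2ℤ`, written multiplicatively. -/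
abbrev Klein : Type := Multiplicative (ZMod 2) × Multiplicative (ZMod 2)

/-- The action of `ℤ/2ℤ` on `V × V` by permutation of the factors. -/
def swapAction : Multiplicative (ZMod 2) →* MulAut (Klein × Klein) where
  toFun t := if t = 1 then 1 else MulEquiv.prodComm
  map_one' := by simp
  map_mul' := by
    have key : ∀ t : Multiplicative (ZMod 2), t = 1 ∨ t = Multiplicative.ofAdd 1 := by decide
    have h1 : (Multiplicative.ofAdd (1 : ZMod 2)) ≠ 1 := by decide
    have h2 : (Multiplicative.ofAdd (1 : ZMod 2)) * Multiplicative.ofAdd 1 = 1 := by decide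
    intro s t
    rcases key s with rfl | rfl <;> rcases key t with rfl | rfl
    · simp
    · simp
    · simp
    · rw [h2, if_pos rfl, if_neg h1]
      ext x <;> rfl

end RhinViola

open RhinViola

/-! Each generator comes from one way of reading the integral.

For `σ`, exchange `x_1` with `1 - x_2`. This preserves `δ_2 = 1 - x_2(1 - x_1)`, hence every `δ_k`
with `k ≥ 2` (`L_sigma`).

For `ψ`, take `d_k = δ_k(x)` as coordinates. Then `x_k = (1 - d_k)/d_{k-1}` and `1 - x_k = (d_{k-1}
+ d_k - 1)/d_{k-1}`. The integrand becomes a product of powers of `1 - d_k`, `d_k` and `d_{k-1} +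
d_k - 1` on the region `0 < d_k < 1 < d_{k-1} + d_k`, and reversing the order of the `d_k` gives `ψ`
(`L_psi`).

For `χ`, integrate over `x_n` first. Since `δ_n = 1 - x_n δ_{n-1}`, the inner integral is an Euler
integral at `z = δ_{n-1}`, and its power series in `z` shows Euler's symmetry `eulerIntegral_symm`
(`L_chi`).

The group permutes eight linear forms, in two quadruples: `χ` and `ψσψ` act on the first, `σ` and
`ψχψ` on the second, and `ψ` exchanges the two. The commutation relations give a homomorphism from
`(V × V) ⋊ ℤ/2ℤ` onto the group; it is injective because the 32 permutations of the forms are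
distinct.

Rationality on the admissible set follows by composing the relations, as this set is stable. For
arbitrary `p`, intermediate values may be infinite. But `L ∘ g` is one of `L`, `L ∘ χ`, `L ∘ χ'`, `L
∘ χχ'` with `χ' = ψχψ`, and finiteness of `L` forces `a_n, b_n, a_1, b_2 ≥ 0`. Finiteness at both
ends then yields all the inequalities needed. -/

namespace RhinViola

/-! ### The group -/

section Abstract

variable {M : Type*} [Group M]

/-- The homomorphism from `ℤ/2ℤ` which sends the generator to a given involution. -/
def involutionHom (g : M) (hg : g * g = 1) : Multiplicative (ZMod 2) →* M where
  toFun t := if t = 1 then 1 else g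
  map_one' := by simp
  map_mul' := by
    have key : ∀ t : Multiplicative (ZMod 2), t = 1 ∨ t = Multiplicative.ofAdd 1 := by decide
    have h1 : (Multiplicative.ofAdd (1 : ZMod 2)) ≠ 1 := by decide
    have h2 : (Multiplicative.ofAdd (1 : ZMod 2)) * Multiplicative.ofAdd 1 = 1 := by decide
    intro s t
    rcases key s with rfl | rfl <;> rcases key t with rfl | rfl
    · simp
    · simp
    · simp
    · rw [h2, if_pos rfl, if_neg h1, hg]

lemma involutionHom_commute {g h : M} (hg : g * g = 1) (hh : h * h = 1) (hc : Commute g h)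
    (s t : Multiplicative (ZMod 2)) : Commute (involutionHom g hg s) (involutionHom h hh t) := by
  simp only [involutionHom, MonoidHom.coe_mk, OneHom.coe_mk]
  split_ifs <;> simp [hc]

/-- The homomorphism from the Klein group given by two commuting involutions. -/
def kleinHom (g h : M) (hg : g * g = 1) (hh : h * h = 1) (hc : Commute g h) : Klein →* M :=
  (involutionHom g hg).noncommCoprod (involutionHom h hh) (involutionHom_commute hg hh hc)

/-- The homomorphism from `(V × V) ⋊ ℤ/2ℤ` given by commuting involutions `g`, `h` and an
involution `s` such that `g`, `h` commute with `s g s`, `s h s`. -/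
def wreathHom (g h s : M) (hg : g * g = 1) (hh : h * h = 1) (hs : s * s = 1)
    (hgh : Commute g h) (hgg : Commute g (s * g * s)) (hg_h : Commute g (s * h * s))
    (hhh : Commute h (s * h * s)) :
    SemidirectProduct (Klein × Klein) (Multiplicative (ZMod 2)) swapAction →* M :=
  have conj : ∀ x y : M, s * (x * y) * s = (s * x * s) * (s * y * s) := fun x y => by
    rw [show s * x * s * (s * y * s) = s * x * (s * s) * y * s by group, hs]; group
  have conj2 : ∀ x : M, s * (s * x * s) * s = x := fun x => by
    rw [show s * (s * x * s) * s = (s * s) * x * (s * s) by group, hs]; group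
  have hg' : (s * g * s) * (s * g * s) = 1 := by rw [← conj, hg, mul_one, hs]
  have hh' : (s * h * s) * (s * h * s) = 1 := by rw [← conj, hh, mul_one, hs]
  have hc' : Commute (s * g * s) (s * h * s) := by
    change _ * _ = _ * _
    rw [← conj, ← conj, hgh.eq]
  -- The one missing commutation is the `s`-conjugate of `hg_h`.
  have h_g : Commute h (s * g * s) := by
    have h1 := congrArg (s * · * s) hg_h.eq
    beta_reduce at h1
    rw [conj g, conj (s * h * s), conj2] at h1
    exact h1.symm
  have hcomm : ∀ x y, Commute (kleinHom g h hg hh hgh x)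
      (kleinHom (s * g * s) (s * h * s) hg' hh' hc' y) := fun x y => by
    simp only [kleinHom, MonoidHom.noncommCoprod_apply]
    exact Commute.mul_left
      (Commute.mul_right (involutionHom_commute hg hg' hgg _ _)
        (involutionHom_commute hg hh' hg_h _ _))
      (Commute.mul_right (involutionHom_commute hh hg' h_g _ _)
        (involutionHom_commute hh hh' hhh _ _))
  have hconj : ∀ x, s * kleinHom g h hg hh hgh x * s =
      kleinHom (s * g * s) (s * h * s) hg' hh' hc' x := fun x => by
    simp only [kleinHom, MonoidHom.noncommCoprod_apply, conj, involutionHom, MonoidHom.coe_mk,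
      OneHom.coe_mk]
    split_ifs <;> simp [hs]
  -- The compatibility to check is that conjugation by `s` exchanges the two Klein factors.
  SemidirectProduct.lift
    ((kleinHom g h hg hh hgh).noncommCoprod (kleinHom (s * g * s) (s * h * s) hg' hh' hc') hcomm)
    (involutionHom s hs)
    (fun t => by
      have hinv : s⁻¹ = s := inv_eq_of_mul_eq_one_left hs
      refine MonoidHom.ext fun x => ?_
      simp only [swapAction, involutionHom, MonoidHom.coe_mk, OneHom.coe_mk,
          MonoidHom.comp_apply, MonoidHom.noncommCoprod_apply, MulEquiv.coe_toMonoidHom,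
          MulAut.conj_apply]
      by_cases ht : t = 1
      · simp [ht]
      · simp only [ht, if_false, MulEquiv.coe_prodComm, Prod.fst_swap, Prod.snd_swap, hinv]
        rw [conj, hconj, ← hconj x.2, conj2, (hcomm x.2 x.1).eq])

end Abstract

/-! ### Relations between the generators and their conjugates by `ψ` -/

variable {n : ℕ}

lemma sigma_apply (hn : 2 ≤ n) (p : Params n) : sigma n hn p = sigmaFun n p := rfl
lemma psi_apply (hn : 2 ≤ n) (p : Params n) : psi n hn p = psiFun n p := rfl
lemma chi_apply (hn : 2 ≤ n) (p : Params n) : chi n hn p = chiFun n p := rfl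

/-- The conjugate of `χ` by `ψ`. -/
def chiConjFun (n : ℕ) (p : Params n) : Params n :=
  ofCoords n
    (fun k => if k = 1 then cA p 2 + cB p 2 - cB p 1 else cA p k)
    (fun k => if k = 2 then cA p 1 + cB p 1 - cA p 2 else cB p k)
    (fun k => cC p k)

lemma psiFun_chiFun_psiFun (hn : 3 ≤ n) (p : Params n) :
    psiFun n (chiFun n (psiFun n p)) = chiConjFun n p := by
  apply params_ext <;> intro k h1 h2 <;>
    simp only [psiFun, chiFun, chiConjFun, cA_ofCoords, cB_ofCoords, cC_ofCoords] <;> grind (splits := 20)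

lemma sigmaFun_chiFun (hn : 3 ≤ n) (p : Params n) :
    sigmaFun n (chiFun n p) = chiFun n (sigmaFun n p) := by
  apply params_ext <;> intro k h1 h2 <;>
    simp only [sigmaFun, chiFun, cA_ofCoords, cB_ofCoords, cC_ofCoords] <;> grind (splits := 20)

lemma sigmaFun_chiConjFun (hn : 3 ≤ n) (p : Params n) :
    sigmaFun n (chiConjFun n p) = chiConjFun n (sigmaFun n p) := by
  apply params_ext <;> intro k h1 h2 <;>
    simp only [sigmaFun, chiConjFun, cA_ofCoords, cB_ofCoords, cC_ofCoords] <;> grind (splits := 20)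

lemma chiFun_chiConjFun (hn : 3 ≤ n) (p : Params n) :
    chiFun n (chiConjFun n p) = chiConjFun n (chiFun n p) := by
  apply params_ext <;> intro k h1 h2 <;>
    simp only [chiFun, chiConjFun, cA_ofCoords, cB_ofCoords, cC_ofCoords] <;> grind (splits := 20)

/-- The conjugate of `σ` by `ψ`; for `n = 3` the quantity `-b_1` plays the role of `c_1`. -/
def sigmaConjFun (n : ℕ) (p : Params n) : Params n :=
  ofCoords n
    (fun k => if k = n then cB p n else if k + 1 = n then cA p k + cB p n - cC p n else cA p k)
    (fun k => if k = n then cA p n else if n = 3 ∧ k = 1 then cB p 1 + cB p 3 - cC p 3 else cB p k)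
    (fun k => if k = n then cA p n + cB p n - cC p n else
      if k + 2 = n then cC p k - cB p n + cC p n else cC p k)

lemma psiFun_sigmaFun_psiFun (hn : 3 ≤ n) (p : Params n) :
    psiFun n (sigmaFun n (psiFun n p)) = sigmaConjFun n p := by
  apply params_ext <;> intro k h1 h2 <;>
    simp only [psiFun, sigmaFun, sigmaConjFun, cA_ofCoords, cB_ofCoords, cC_ofCoords] <;> grind (splits := 20)

lemma sigmaFun_sigmaConjFun (hn : 3 ≤ n) (p : Params n) :
    sigmaFun n (sigmaConjFun n p) = sigmaConjFun n (sigmaFun n p) := by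
  apply params_ext <;> intro k h1 h2 <;>
    simp only [sigmaFun, sigmaConjFun, cA_ofCoords, cB_ofCoords, cC_ofCoords] <;> grind (splits := 20)

lemma wreathHom_apply {M : Type*} [Group M] (g h s : M) (hg : g * g = 1) (hh : h * h = 1)
    (hs : s * s = 1) (hgh : Commute g h) (hgg : Commute g (s * g * s))
    (hg_h : Commute g (s * h * s)) (hhh : Commute h (s * h * s))
    (w : SemidirectProduct (Klein × Klein) (Multiplicative (ZMod 2)) swapAction) :
    wreathHom g h s hg hh hs hgh hgg hg_h hhh w =
      (if w.left.1.1 = 1 then 1 else g) * (if w.left.1.2 = 1 then 1 else h) *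
        ((if w.left.2.1 = 1 then 1 else s * g * s) * (if w.left.2.2 = 1 then 1 else s * h * s)) *
        (if w.right = 1 then 1 else s) := by
  rfl

lemma wreathHom_range {M : Type*} [Group M] (g h s : M) (hg : g * g = 1) (hh : h * h = 1)
    (hs : s * s = 1) (hgh : Commute g h) (hgg : Commute g (s * g * s))
    (hg_h : Commute g (s * h * s)) (hhh : Commute h (s * h * s)) :
    (wreathHom g h s hg hh hs hgh hgg hg_h hhh).range = Subgroup.closure {g, s, h} := by
  have mg : g ∈ Subgroup.closure {g, s, h} := Subgroup.subset_closure (by simp)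
  have ms : s ∈ Subgroup.closure {g, s, h} := Subgroup.subset_closure (by simp)
  have mh : h ∈ Subgroup.closure {g, s, h} := Subgroup.subset_closure (by simp)
  have h1 : (Multiplicative.ofAdd (1 : ZMod 2)) ≠ 1 := by decide
  apply le_antisymm
  · rintro _ ⟨w, rfl⟩
    rw [wreathHom_apply]
    have ite_mem : ∀ (t : Multiplicative (ZMod 2)) (x : M), x ∈ Subgroup.closure {g, s, h} →
        (if t = 1 then 1 else x) ∈ Subgroup.closure {g, s, h} := fun t x hx => by
      split_ifs
      · exact one_mem _
      · exact hx
    exact mul_mem (mul_mem (mul_mem (ite_mem _ _ mg) (ite_mem _ _ mh))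
      (mul_mem (ite_mem _ _ (mul_mem (mul_mem ms mg) ms))
        (ite_mem _ _ (mul_mem (mul_mem ms mh) ms)))) (ite_mem _ _ ms)
  · rw [Subgroup.closure_le]
    rintro x (rfl | rfl | rfl)
    · exact ⟨⟨((Multiplicative.ofAdd 1, 1), 1), 1⟩, by rw [wreathHom_apply]; simp [h1]⟩
    · exact ⟨⟨1, Multiplicative.ofAdd 1⟩, by rw [wreathHom_apply]; simp [h1]⟩
    · exact ⟨⟨((1, Multiplicative.ofAdd 1), 1), 1⟩, by rw [wreathHom_apply]; simp [h1]⟩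

/-! ### Action on the eight linear forms -/

/-- The eight linear forms permuted by the group. -/
def forms (p : Params n) : Fin 8 → ℤ :=
  ![cA p n, cB p n, cC p n, cA p n + cB p n - cC p n,
    cA p 1, cB p 2, cA p 2 + cB p 2 - cB p 1, cA p 1 + cB p 1 - cA p 2]

lemma mem_Admissible_iff (p : Params n) : p ∈ Admissible n ↔ ∀ i, 0 ≤ forms p i := by
  simp [Admissible, ChiDomain, forms, Fin.forall_fin_succ, and_assoc]

lemma forms_sigmaFun (hn : 3 ≤ n) (p : Params n) :
    forms (sigmaFun n p) = forms p ∘ ![0, 1, 2, 3, 5, 4, 7, 6] := by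
  funext i
  fin_cases i <;> simp [forms, sigmaFun, cA_ofCoords, cB_ofCoords, cC_ofCoords] <;> grind

lemma forms_chiFun (hn : 3 ≤ n) (p : Params n) :
    forms (chiFun n p) = forms p ∘ ![2, 3, 0, 1, 4, 5, 6, 7] := by
  funext i
  fin_cases i <;> simp [forms, chiFun, cA_ofCoords, cB_ofCoords, cC_ofCoords] <;> grind

lemma forms_psiFun (hn : 3 ≤ n) (p : Params n) :
    forms (psiFun n p) = forms p ∘ ![4, 5, 6, 7, 0, 1, 2, 3] := by
  funext i
  fin_cases i <;> simp [forms, psiFun, cA_ofCoords, cB_ofCoords, cC_ofCoords] <;> grind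

lemma sigma_mul_self (hn : 2 ≤ n) : sigma n hn * sigma n hn = 1 :=
  -- An equivalence built by `LinearEquiv.ofInvolutive` is definitionally its own inverse.
  LinearEquiv.ext fun p => LinearEquiv.symm_apply_apply (sigma n hn) p

lemma psi_mul_self (hn : 2 ≤ n) : psi n hn * psi n hn = 1 :=
  LinearEquiv.ext fun p => LinearEquiv.symm_apply_apply (psi n hn) p

lemma chi_mul_self (hn : 2 ≤ n) : chi n hn * chi n hn = 1 :=
  LinearEquiv.ext fun p => LinearEquiv.symm_apply_apply (chi n hn) p

lemma psi_chi_psi_apply (hn : 3 ≤ n) (p : Params n) :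
    (psi n (Nat.le_of_succ_le hn) * chi n (Nat.le_of_succ_le hn) *
      psi n (Nat.le_of_succ_le hn)) p = chiConjFun n p :=
  psiFun_chiFun_psiFun hn p

lemma psi_sigma_psi_apply (hn : 3 ≤ n) (p : Params n) :
    (psi n (Nat.le_of_succ_le hn) * sigma n (Nat.le_of_succ_le hn) *
      psi n (Nat.le_of_succ_le hn)) p = sigmaConjFun n p :=
  psiFun_sigmaFun_psiFun hn p

lemma sigma_commute_chi (hn : 3 ≤ n) :
    Commute (sigma n (Nat.le_of_succ_le hn)) (chi n (Nat.le_of_succ_le hn)) :=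
  LinearEquiv.ext (sigmaFun_chiFun hn)

lemma sigma_commute_psi_chi_psi (hn : 3 ≤ n) :
    Commute (sigma n (Nat.le_of_succ_le hn)) (psi n (Nat.le_of_succ_le hn) *
      chi n (Nat.le_of_succ_le hn) * psi n (Nat.le_of_succ_le hn)) :=
  LinearEquiv.ext fun p => by
    rw [LinearEquiv.mul_apply (sigma n _), LinearEquiv.mul_apply (psi n _ * _ * _) (sigma n _),
      psi_chi_psi_apply hn, psi_chi_psi_apply hn]
    exact sigmaFun_chiConjFun hn p

lemma chi_commute_psi_chi_psi (hn : 3 ≤ n) :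
    Commute (chi n (Nat.le_of_succ_le hn)) (psi n (Nat.le_of_succ_le hn) *
      chi n (Nat.le_of_succ_le hn) * psi n (Nat.le_of_succ_le hn)) :=
  LinearEquiv.ext fun p => by
    rw [LinearEquiv.mul_apply (chi n _), LinearEquiv.mul_apply (psi n _ * _ * _) (chi n _),
      psi_chi_psi_apply hn, psi_chi_psi_apply hn]
    exact chiFun_chiConjFun hn p

lemma sigma_commute_psi_sigma_psi (hn : 3 ≤ n) :
    Commute (sigma n (Nat.le_of_succ_le hn)) (psi n (Nat.le_of_succ_le hn) *
      sigma n (Nat.le_of_succ_le hn) * psi n (Nat.le_of_succ_le hn)) :=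
  LinearEquiv.ext fun p => by
    rw [LinearEquiv.mul_apply (sigma n _), LinearEquiv.mul_apply (psi n _ * _ * _) (sigma n _),
      psi_sigma_psi_apply hn, psi_sigma_psi_apply hn]
    exact sigmaFun_sigmaConjFun hn p

/-- The parametrization of the group generated by `σ`, `ψ`, `χ`. -/
def groupHom (n : ℕ) (hn : 3 ≤ n) :
    SemidirectProduct (Klein × Klein) (Multiplicative (ZMod 2)) swapAction →* GLZ (Index n) :=
  wreathHom (sigma n (Nat.le_of_succ_le hn)) (chi n (Nat.le_of_succ_le hn))
    (psi n (Nat.le_of_succ_le hn)) (sigma_mul_self _) (chi_mul_self _) (psi_mul_self _)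
    (sigma_commute_chi hn) (sigma_commute_psi_sigma_psi hn) (sigma_commute_psi_chi_psi hn)
    (chi_commute_psi_chi_psi hn)

lemma groupHom_range (hn : 3 ≤ n) :
    (groupHom n hn).range = group n (Nat.le_of_succ_le hn) :=
  wreathHom_range _ _ _ _ _ _ _ _ _ _

lemma forms_ite {g : GLZ (Index n)} {π : Fin 8 → Fin 8} (hg : ∀ p, forms (g p) = forms p ∘ π)
    (t : Multiplicative (ZMod 2)) (p : Params n) :
    forms ((if t = 1 then 1 else g) p) = forms p ∘ (if t = 1 then id else π) := by
  split_ifs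
  · rfl
  · exact hg p

lemma exists_forms_injective (hn : 3 ≤ n) : ∃ p : Params n, Function.Injective (forms p) := by
  -- The eight forms take the values 1, 4, 2, 3, 10, 40, 20, 30 at this point; `n ≥ 3` ensures `a_2
  -- = 0` and `b_n = 4`.
  refine ⟨ofCoords n (fun k => if k = 1 then 10 else if k = n then 1 else 0)
    (fun k => if k = 1 then 20 else if k = 2 then 40 else 4) (fun _ => 2), ?_⟩
  have h1 : n ≠ 1 := by omega
  have h2 : n ≠ 2 := by omega
  have h3 : 2 ≠ n := by omega
  have h4 : 1 ≤ n := by omega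
  have h5 : 2 ≤ n := by omega
  have h6 : 1 ≠ n := by omega
  simp only [forms, cA_ofCoords, cB_ofCoords, cC_ofCoords, h1, h2, h3, h4, h5, h6, le_refl,
    and_self, if_true, if_false, show (1 : ℕ) ≤ 2 by norm_num, show (2 : ℕ) ≠ 1 by norm_num,
    show (1 : ℕ) ≠ 2 by norm_num]
  decide

lemma forms_sigma (hn : 3 ≤ n) (p : Params n) :
    forms (sigma n (Nat.le_of_succ_le hn) p) = forms p ∘ ![0, 1, 2, 3, 5, 4, 7, 6] := by
  rw [sigma_apply, forms_sigmaFun hn]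

lemma forms_chi (hn : 3 ≤ n) (p : Params n) :
    forms (chi n (Nat.le_of_succ_le hn) p) = forms p ∘ ![2, 3, 0, 1, 4, 5, 6, 7] := by
  rw [chi_apply, forms_chiFun hn]

lemma forms_psi (hn : 3 ≤ n) (p : Params n) :
    forms (psi n (Nat.le_of_succ_le hn) p) = forms p ∘ ![4, 5, 6, 7, 0, 1, 2, 3] := by
  rw [psi_apply, forms_psiFun hn]

lemma forms_psi_sigma_psi (hn : 3 ≤ n) (p : Params n) :
    forms ((psi n (Nat.le_of_succ_le hn) * sigma n (Nat.le_of_succ_le hn) *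
      psi n (Nat.le_of_succ_le hn)) p) = forms p ∘ ![1, 0, 3, 2, 4, 5, 6, 7] := by
  rw [LinearEquiv.mul_apply, LinearEquiv.mul_apply, forms_psi hn, forms_sigma hn, forms_psi hn,
    Function.comp_assoc, Function.comp_assoc]
  congr 1
  decide

lemma forms_psi_chi_psi (hn : 3 ≤ n) (p : Params n) :
    forms ((psi n (Nat.le_of_succ_le hn) * chi n (Nat.le_of_succ_le hn) *
      psi n (Nat.le_of_succ_le hn)) p) = forms p ∘ ![0, 1, 2, 3, 6, 7, 4, 5] := by
  rw [LinearEquiv.mul_apply, LinearEquiv.mul_apply, forms_psi hn, forms_chi hn, forms_psi hn,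
    Function.comp_assoc, Function.comp_assoc]
  congr 1
  decide

/-- Faithfulness as a finite check over 32 cases: `true` marks an absent factor. Forms are pulled
back, so the permutations compose in the order opposite to that of the group elements. -/
lemma eq_true_of_comp_eq_id : ∀ s t s' t' r : Bool,
    (∀ i : Fin 8, (if r then id else ![4, 5, 6, 7, 0, 1, 2, 3] : Fin 8 → Fin 8)
      ((if t' then id else ![0, 1, 2, 3, 6, 7, 4, 5] : Fin 8 → Fin 8)
      ((if s' then id else ![1, 0, 3, 2, 4, 5, 6, 7] : Fin 8 → Fin 8)
      ((if t then id else ![2, 3, 0, 1, 4, 5, 6, 7] : Fin 8 → Fin 8)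
      ((if s then id else ![0, 1, 2, 3, 5, 4, 7, 6] : Fin 8 → Fin 8) i)))) = i) →
    s = true ∧ t = true ∧ s' = true ∧ t' = true ∧ r = true := by decide

lemma groupHom_injective (hn : 3 ≤ n) : Function.Injective (groupHom n hn) := by
  rw [injective_iff_map_eq_one]
  rintro ⟨⟨⟨s, t⟩, ⟨s', t'⟩⟩, r⟩ h
  obtain ⟨p, hp⟩ := exists_forms_injective hn
  have key : forms (groupHom n hn ⟨⟨⟨s, t⟩, ⟨s', t'⟩⟩, r⟩ p) = forms p := by
    rw [h, LinearEquiv.coe_one, id_eq]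
  simp only [groupHom, wreathHom_apply] at key
  simp only [LinearEquiv.mul_apply (_ * _), LinearEquiv.mul_apply (ite _ _ _)] at key
  rw [forms_ite (forms_sigma hn), forms_ite (forms_chi hn), forms_ite (forms_psi_sigma_psi hn),
    forms_ite (forms_psi_chi_psi hn), forms_ite (forms_psi hn)] at key
  have h32 := eq_true_of_comp_eq_id (decide (s = 1)) (decide (t = 1)) (decide (s' = 1))
    (decide (t' = 1)) (decide (r = 1)) (fun i => hp (by
      have h1 := congrFun key i
      simp only [Function.comp_apply] at h1
      simp only [decide_eq_true_eq]
      exact h1))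
  simp only [decide_eq_true_eq] at h32
  obtain ⟨rfl, rfl, rfl, rfl, rfl⟩ := h32
  rfl

lemma card_group (hn : 3 ≤ n) : Nat.card (group n (Nat.le_of_succ_le hn)) = 32 := by
  rw [← groupHom_range hn,
    ← Nat.card_congr ((groupHom n hn).ofInjective (groupHom_injective hn)).toEquiv,
    SemidirectProduct.card]
  simp

/-! ### The Euler integral -/

/-- Restates that the beta density has total mass 1. -/
lemma lintegral_pow_mul_one_sub_pow (p q : ℕ) :
    ∫⁻ x in Set.Ioo (0 : ℝ) 1, ENNReal.ofReal (x ^ p * (1 - x) ^ q) =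
      ENNReal.ofReal ((p.factorial * q.factorial : ℝ) / (p + q + 1).factorial) := by
  have hp : (0 : ℝ) < p + 1 := by positivity
  have hq : (0 : ℝ) < q + 1 := by positivity
  have h1 := ProbabilityTheory.lintegral_betaPDF_eq_one hp hq
  have hB : ProbabilityTheory.beta (p + 1) (q + 1) =
      (p.factorial * q.factorial : ℝ) / (p + q + 1).factorial := by
    rw [ProbabilityTheory.beta, Real.Gamma_nat_eq_factorial, Real.Gamma_nat_eq_factorial,
      show (p : ℝ) + 1 + (q + 1) = ((p + q + 1 : ℕ) : ℝ) + 1 by push_cast; ring,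
      Real.Gamma_nat_eq_factorial]
  have hBpos := ProbabilityTheory.beta_pos hp hq
  rw [ProbabilityTheory.lintegral_betaPDF] at h1
  rw [← hB]
  have h2 : ∫⁻ x in Set.Ioo (0 : ℝ) 1, ENNReal.ofReal (x ^ p * (1 - x) ^ q) =
      ∫⁻ x in Set.Ioo (0 : ℝ) 1, ENNReal.ofReal (ProbabilityTheory.beta (p + 1) (q + 1)) *
        ENNReal.ofReal (1 / ProbabilityTheory.beta (p + 1) (q + 1) *
          x ^ ((p : ℝ) + 1 - 1) * (1 - x) ^ ((q : ℝ) + 1 - 1)) := by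
    refine setLIntegral_congr_fun measurableSet_Ioo fun x hx => ?_
    rw [← ENNReal.ofReal_mul hBpos.le, add_sub_cancel_right, add_sub_cancel_right,
      Real.rpow_natCast, Real.rpow_natCast]
    congr 1
    field_simp
  rw [h2, lintegral_const_mul' _ _ ENNReal.ofReal_ne_top, h1, mul_one]

/-- The Euler integral `∫ x^a (1-x)^b (1-xz)^(-c-1) dx` over the unit interval. -/
noncomputable def eulerIntegral (a b c : ℤ) (z : ℝ) : ℝ≥0∞ :=
  ∫⁻ x in Set.Ioo (0 : ℝ) 1, ENNReal.ofReal (x ^ a * (1 - x) ^ b / (1 - x * z) ^ (c + 1))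

/-- Expand `(1 - xz)^(-c-1)` as a binomial series and integrate term by term; all terms are
nonnegative, so the exchange is free. -/
lemma eulerIntegral_eq_tsum (a b c : ℕ) {z : ℝ} (hz : z ∈ Set.Ioo (0 : ℝ) 1) :
    eulerIntegral a b c z = ∑' k : ℕ, ENNReal.ofReal
      (((k + c).choose c : ℝ) * z ^ k *
        (((a + k).factorial * b.factorial : ℝ) / (a + k + b + 1).factorial)) := by
  have h1 : eulerIntegral a b c z = ∫⁻ x in Set.Ioo (0 : ℝ) 1, ∑' k : ℕ,
      ENNReal.ofReal (((k + c).choose c : ℝ) * z ^ k) *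
        ENNReal.ofReal (x ^ (a + k) * (1 - x) ^ b) := by
    refine setLIntegral_congr_fun measurableSet_Ioo fun x hx => ?_
    have hx0 := hx.1
    have hx1 : 0 < 1 - x := sub_pos.2 hx.2
    have hz0 := hz.1
    have hxz : ‖x * z‖ < 1 := by
      rw [Real.norm_of_nonneg (by positivity)]
      exact mul_lt_one_of_nonneg_of_lt_one_left hx.1.le hx.2 hz.2.le
    have hs := (hasSum_choose_mul_geometric_of_norm_lt_one c hxz).mul_left
      (x ^ a * (1 - x) ^ b)
    have hn : ∀ k : ℕ, 0 ≤ x ^ a * (1 - x) ^ b * (((k + c).choose c : ℝ) * (x * z) ^ k) :=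
      fun k => by positivity
    have h2 : x ^ (a : ℤ) * (1 - x) ^ (b : ℤ) / (1 - x * z) ^ ((c : ℤ) + 1) =
        x ^ a * (1 - x) ^ b * (1 / (1 - x * z) ^ (c + 1)) := by
      rw [zpow_natCast, zpow_natCast, ← Nat.cast_succ, zpow_natCast, mul_one_div]
    rw [h2, ← hs.tsum_eq, ENNReal.ofReal_tsum_of_nonneg hn hs.summable]
    refine tsum_congr fun k => ?_
    rw [← ENNReal.ofReal_mul (by positivity)]
    congr 1
    rw [mul_pow, pow_add]
    ring
  rw [h1, lintegral_tsum fun k => by fun_prop]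
  refine tsum_congr fun k => ?_
  rw [lintegral_const_mul' _ _ ENNReal.ofReal_ne_top, lintegral_pow_mul_one_sub_pow,
    ← ENNReal.ofReal_mul (by have := hz.1; positivity)]

/-- The coefficient of `z^k` on the left is `(b!/c!) (a+k)! (c+k)! / (k! (a+b+k+1)!)`. Apart from
`b!/c!` it is symmetric in `a` and `c` once `a + b = c + d`. -/
lemma eulerIntegral_symm {a b c d : ℕ} (h : a + b = c + d) {z : ℝ} (hz : z ∈ Set.Ioo (0 : ℝ) 1) :
    eulerIntegral a b c z =
      ((a.factorial * b.factorial : ℕ) : ℝ≥0∞) / ((c.factorial * d.factorial : ℕ) : ℝ≥0∞) *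
        eulerIntegral c d a z := by
  have hz0 := hz.1
  have hpos : (0 : ℝ) < ((c.factorial * d.factorial : ℕ) : ℝ) := by positivity
  have hq : ((a.factorial * b.factorial : ℕ) : ℝ≥0∞) / ((c.factorial * d.factorial : ℕ) : ℝ≥0∞) =
      ENNReal.ofReal (((a.factorial * b.factorial : ℕ) : ℝ) /
        ((c.factorial * d.factorial : ℕ) : ℝ)) := by
    rw [ENNReal.ofReal_div_of_pos hpos, ENNReal.ofReal_natCast, ENNReal.ofReal_natCast]
  rw [hq, eulerIntegral_eq_tsum a b c hz, eulerIntegral_eq_tsum c d a hz, ← ENNReal.tsum_mul_left]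
  refine tsum_congr fun k => ?_
  rw [← ENNReal.ofReal_mul (by positivity)]
  congr 1
  have e1 : a + k + b + 1 = c + k + d + 1 := by omega
  rw [e1, Nat.cast_choose ℝ (Nat.le_add_left c k), Nat.cast_choose ℝ (Nat.le_add_left a k),
    Nat.add_sub_cancel, Nat.add_sub_cancel, add_comm k c, add_comm k a]
  push_cast
  field_simp

/-! ### Divergence of the Euler integral for negative exponents -/

lemma lintegral_inv_Ioo {r : ℝ} (hr : 0 < r) :
    ∫⁻ x in Set.Ioo (0 : ℝ) r, ENNReal.ofReal x⁻¹ = ∞ := by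
  by_contra h
  have hI : IntegrableOn (fun x : ℝ => x⁻¹) (Set.Ioo 0 r) := by
    refine ⟨by fun_prop, ?_⟩
    rw [hasFiniteIntegral_iff_ofReal]
    · exact lt_top_iff_ne_top.2 h
    · exact ae_restrict_of_forall_mem measurableSet_Ioo fun x hx => inv_nonneg.2 hx.1.le
  rw [← integrableOn_Ioc_iff_integrableOn_Ioo,
    ← intervalIntegrable_iff_integrableOn_Ioc_of_le hr.le] at hI
  have := intervalIntegrable_inv_iff.1 hI
  simp [hr.ne, hr.le] at this

lemma lintegral_inv_one_sub_Ioo {r : ℝ} (hr : r < 1) :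
    ∫⁻ x in Set.Ioo r 1, ENNReal.ofReal (1 - x)⁻¹ = ∞ := by
  have h := (Measure.measurePreserving_sub_left volume (1 : ℝ)).setLIntegral_comp_preimage_emb
    (MeasurableEquiv.subLeft (1 : ℝ)).measurableEmbedding (fun x => ENNReal.ofReal x⁻¹)
    (Set.Ioo 0 (1 - r))
  rw [lintegral_inv_Ioo (sub_pos.2 hr)] at h
  rw [← h]
  congr 2
  ext x
  simp only [Set.mem_Ioo, Set.mem_preimage]
  constructor <;> rintro ⟨h1, h2⟩ <;> constructor <;> linarith

/-- By compactness `f` is bounded below by a positive constant, so the divergence of `∫ g` passes to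
`∫ h`. -/
lemma lintegral_eq_top_of_continuousOn {u v : ℝ} (huv : u ≤ v) {f : ℝ → ℝ} {g h : ℝ → ℝ≥0∞}
    (hf : ContinuousOn f (Set.Icc u v)) (hpos : ∀ x ∈ Set.Icc u v, 0 < f x)
    (hg : ∫⁻ x in Set.Ioo u v, g x = ∞)
    (hle : ∀ x ∈ Set.Ioo u v, ENNReal.ofReal (f x) * g x ≤ h x) :
    ∫⁻ x in Set.Ioo u v, h x = ∞ := by
  obtain ⟨x₀, hx₀, hmin⟩ := isCompact_Icc.exists_isMinOn (Set.nonempty_Icc.2 huv) hf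
  rw [eq_top_iff]
  calc ∞ = ENNReal.ofReal (f x₀) * ∫⁻ x in Set.Ioo u v, g x := by
        rw [hg, ENNReal.mul_top (ENNReal.ofReal_pos.2 (hpos _ hx₀)).ne']
    _ = ∫⁻ x in Set.Ioo u v, ENNReal.ofReal (f x₀) * g x := by
        rw [lintegral_const_mul' _ _ ENNReal.ofReal_ne_top]
    _ ≤ ∫⁻ x in Set.Ioo u v, h x := by
        refine setLIntegral_mono' measurableSet_Ioo fun x hx => le_trans ?_ (hle x hx)
        gcongr
        exact hmin (Set.Ioo_subset_Icc_self hx)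

lemma inv_le_zpow_of_neg {x : ℝ} (hx : x ∈ Set.Ioo (0 : ℝ) 1) {a : ℤ} (ha : a < 0) :
    x⁻¹ ≤ x ^ a := by
  rw [← zpow_neg_one]
  exact zpow_le_zpow_right_of_le_one₀ hx.1 hx.2.le (by omega)

/-- Near `0` the integrand is at least a constant times `1/x`; stopping at `1/2` keeps `1 - x` away
from zero. -/
lemma eulerIntegral_eq_top_left {a : ℤ} (b c : ℤ) {z : ℝ} (hz : z ∈ Set.Ioo (0 : ℝ) 1)
    (ha : a < 0) : eulerIntegral a b c z = ∞ := by
  have hpos : ∀ x ∈ Set.Icc (0 : ℝ) (1 / 2), 0 < 1 - x ∧ 0 < 1 - x * z := fun x hx => by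
    have h1 := hx.1
    have h2 := hx.2
    have h3 := hz.1
    have h4 := hz.2
    constructor <;> nlinarith
  have hsub : Set.Ioo (0 : ℝ) (1 / 2) ⊆ Set.Ioo 0 1 := Set.Ioo_subset_Ioo_right (by norm_num)
  rw [eq_top_iff, ← lintegral_eq_top_of_continuousOn (u := 0) (v := 1 / 2) (by norm_num)
    (f := fun x => (1 - x) ^ b / (1 - x * z) ^ (c + 1))
    (h := fun x => ENNReal.ofReal (x ^ a * (1 - x) ^ b / (1 - x * z) ^ (c + 1))) ?_ ?_
    (lintegral_inv_Ioo (by norm_num)) ?_]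
  · exact lintegral_mono_set hsub
  · refine ContinuousOn.div (ContinuousOn.zpow₀ (by fun_prop) b fun x hx => ?_)
      (ContinuousOn.zpow₀ (by fun_prop) _ fun x hx => ?_) fun x hx => ?_
    · exact Or.inl (hpos x hx).1.ne'
    · exact Or.inl (hpos x hx).2.ne'
    · exact (zpow_pos (hpos x hx).2 _).ne'
  · exact fun x hx => div_pos (zpow_pos (hpos x hx).1 _) (zpow_pos (hpos x hx).2 _)
  · intro x hx
    have h1 := zpow_pos (hpos x (Set.Ioo_subset_Icc_self hx)).1 b
    have h2 := zpow_pos (hpos x (Set.Ioo_subset_Icc_self hx)).2 (c + 1)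
    rw [← ENNReal.ofReal_mul (by positivity), mul_comm, mul_div_assoc]
    gcongr
    exact inv_le_zpow_of_neg (hsub hx) ha

lemma eulerIntegral_eq_top_right (a : ℤ) {b : ℤ} (c : ℤ) {z : ℝ} (hz : z ∈ Set.Ioo (0 : ℝ) 1)
    (hb : b < 0) : eulerIntegral a b c z = ∞ := by
  have hpos : ∀ x ∈ Set.Icc (1 / 2 : ℝ) 1, 0 < x ∧ 0 < 1 - x * z := fun x hx => by
    have h1 := hx.1
    have h2 := hx.2
    have h3 := hz.1
    have h4 := hz.2
    constructor <;> nlinarith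
  have hsub : Set.Ioo (1 / 2 : ℝ) 1 ⊆ Set.Ioo 0 1 := Set.Ioo_subset_Ioo_left (by norm_num)
  rw [eq_top_iff, ← lintegral_eq_top_of_continuousOn (u := 1 / 2) (v := 1) (by norm_num)
    (f := fun x => x ^ a / (1 - x * z) ^ (c + 1))
    (h := fun x => ENNReal.ofReal (x ^ a * (1 - x) ^ b / (1 - x * z) ^ (c + 1))) ?_ ?_
    (lintegral_inv_one_sub_Ioo (by norm_num)) ?_]
  · exact lintegral_mono_set hsub
  · refine ContinuousOn.div (ContinuousOn.zpow₀ (by fun_prop) a fun x hx => ?_)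
      (ContinuousOn.zpow₀ (by fun_prop) _ fun x hx => ?_) fun x hx => ?_
    · exact Or.inl (hpos x hx).1.ne'
    · exact Or.inl (hpos x hx).2.ne'
    · exact (zpow_pos (hpos x hx).2 _).ne'
  · exact fun x hx => div_pos (zpow_pos (hpos x hx).1 _) (zpow_pos (hpos x hx).2 _)
  · intro x hx
    have h1 := zpow_pos (hpos x (Set.Ioo_subset_Icc_self hx)).1 a
    have h2 := zpow_pos (hpos x (Set.Ioo_subset_Icc_self hx)).2 (c + 1)
    rw [← ENNReal.ofReal_mul (by positivity), div_mul_eq_mul_div]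
    gcongr
    exact inv_le_zpow_of_neg ⟨sub_pos.2 hx.2, by linarith [(hsub hx).1]⟩ hb

/-! ### Integration over the last variable -/

/-- The open unit cube. -/
def cube (n : ℕ) : Set (Fin n → ℝ) := Set.univ.pi fun _ => Set.Ioo 0 1

lemma mem_cube {x : Fin n → ℝ} : x ∈ cube n ↔ ∀ i, x i ∈ Set.Ioo (0 : ℝ) 1 := by
  simp [cube]

lemma measurableSet_cube : MeasurableSet (cube n) :=
  MeasurableSet.univ_pi fun _ => measurableSet_Ioo

lemma volume_cube : volume (cube n) = 1 := by
  rw [cube, volume_pi_pi]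
  simp

/-- The integrand of `L p`. -/
noncomputable def integrand (p : Params n) (x : Fin n → ℝ) : ℝ :=
  (∏ i : Fin n, x i ^ cA p (i + 1) * (1 - x i) ^ cB p (i + 1)) /
    (∏ k ∈ Finset.Icc 2 n, delta x k ^ cC p k) / delta x n

/-- The boundary is a null set. On the open cube every base of a power is positive, which makes
integer exponents of any sign harmless. -/
lemma L_eq_lintegral_cube (p : Params n) :
    L n p = ∫⁻ x in cube n, ENNReal.ofReal (integrand p x) :=
  (setLIntegral_congr (Measure.univ_pi_Ioo_ae_eq_Icc (μ := fun _ : Fin n => volume)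
    (f := 0) (g := 1))).symm

@[fun_prop]
lemma measurable_delta (k : ℕ) : Measurable fun x : Fin n → ℝ => delta x k := by
  induction k with
  | zero => exact measurable_const
  | succ k ih =>
    simp only [delta]
    split_ifs <;> fun_prop

@[fun_prop]
lemma measurable_integrand (p : Params n) : Measurable (integrand p) := by
  unfold integrand
  refine Measurable.div (Measurable.div ?_ ?_) (measurable_delta n)
  · exact Finset.measurable_prod _ fun i _ => by fun_prop
  · exact Finset.measurable_prod _ fun i _ => by fun_prop

lemma delta_zero (x : Fin n → ℝ) : delta x 0 = 1 := rfl

lemma delta_succ (x : Fin n → ℝ) (k : Fin n) : delta x (k + 1) = 1 - x k * delta x k := by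
  simp [delta]

lemma delta_mem_Ioc {x : Fin n → ℝ} (hx : x ∈ cube n) {k : ℕ} (hk : k ≤ n) :
    delta x k ∈ Set.Ioc (0 : ℝ) 1 := by
  induction k with
  | zero => simp [delta_zero]
  | succ k ih =>
    obtain ⟨h1, h2⟩ := ih (by omega)
    obtain ⟨h3, h4⟩ := mem_cube.1 hx ⟨k, hk⟩
    rw [delta_succ x ⟨k, hk⟩]
    constructor <;> nlinarith

lemma delta_lt_one {x : Fin n → ℝ} (hx : x ∈ cube n) {k : ℕ} (hk : k + 1 ≤ n) :
    delta x (k + 1) < 1 := by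
  obtain ⟨h1, h2⟩ := delta_mem_Ioc hx (k := k) (by omega)
  obtain ⟨h3, h4⟩ := mem_cube.1 hx ⟨k, hk⟩
  rw [delta_succ x ⟨k, hk⟩]
  nlinarith

lemma delta_mem_Ioo {x : Fin n → ℝ} (hx : x ∈ cube n) {k : ℕ} (hk0 : 1 ≤ k) (hk : k ≤ n) :
    delta x k ∈ Set.Ioo (0 : ℝ) 1 := by
  obtain ⟨k, rfl⟩ := Nat.exists_eq_add_of_le' hk0
  exact ⟨(delta_mem_Ioc hx hk).1, delta_lt_one hx hk⟩

lemma prod_delta_pos (c : ℕ → ℤ) {x : Fin n → ℝ} (hx : x ∈ cube n) {m : ℕ} (hm : m ≤ n) :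
    0 < ∏ k ∈ Finset.Icc 2 m, delta x k ^ c k :=
  Finset.prod_pos fun _ hk => zpow_pos
    (delta_mem_Ioc hx ((Finset.mem_Icc.1 hk).2.trans hm)).1 _

lemma prod_zpow_pos (a b : Fin n → ℤ) {x : Fin n → ℝ} (hx : x ∈ cube n) :
    0 < ∏ i : Fin n, x i ^ a i * (1 - x i) ^ b i :=
  Finset.prod_pos fun i _ => mul_pos (zpow_pos (mem_cube.1 hx i).1 _)
    (zpow_pos (sub_pos.2 (mem_cube.1 hx i).2) _)

lemma integrand_pos (p : Params n) {x : Fin n → ℝ} (hx : x ∈ cube n) : 0 < integrand p x :=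
  div_pos (div_pos (prod_zpow_pos _ _ hx) (prod_delta_pos _ hx le_rfl))
    (delta_mem_Ioc hx le_rfl).1

lemma L_pos (p : Params n) : 0 < L n p := by
  rw [L_eq_lintegral_cube, setLIntegral_pos_iff (by fun_prop)]
  refine lt_of_lt_of_le (by rw [volume_cube]; exact one_pos) (measure_mono (s := cube n) ?_)
  exact fun x hx => ⟨(ENNReal.ofReal_pos.2 (integrand_pos p hx)).ne', hx⟩

lemma delta_castSucc (x : Fin (n + 1) → ℝ) {k : ℕ} (hk : k ≤ n) :
    delta (fun i : Fin n => x i.castSucc) k = delta x k := by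
  induction k with
  | zero => rfl
  | succ k ih =>
    rw [delta_succ _ ⟨k, hk⟩, delta_succ x ⟨k, by omega⟩, ih (by omega)]
    rfl

/-- The part of the integrand which does not involve the last variable. -/
noncomputable def initIntegrand (p : Params (n + 1)) (y : Fin n → ℝ) : ℝ :=
  (∏ i : Fin n, y i ^ cA p (i + 1) * (1 - y i) ^ cB p (i + 1)) /
    (∏ k ∈ Finset.Icc 2 n, delta y k ^ cC p k)

lemma initIntegrand_pos (p : Params (n + 1)) {y : Fin n → ℝ} (hy : y ∈ cube n) :
    0 < initIntegrand p y :=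
  div_pos (prod_zpow_pos _ _ hy) (prod_delta_pos _ hy le_rfl)

@[fun_prop]
lemma measurable_initIntegrand (p : Params (n + 1)) : Measurable (initIntegrand p) := by
  unfold initIntegrand
  refine Measurable.div ?_ ?_
  · exact Finset.measurable_prod _ fun i _ => by fun_prop
  · exact Finset.measurable_prod _ fun i _ => by fun_prop

/-- Only the last `δ` involves the last variable; the extra division by it accounts for the exponent
`c + 1`. -/
lemma integrand_eq (hn : 1 ≤ n) (p : Params (n + 1)) {x : Fin (n + 1) → ℝ}
    (hx : x ∈ cube (n + 1)) :
    integrand p x = initIntegrand p (fun i : Fin n => x i.castSucc) *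
      (x (Fin.last n) ^ cA p (n + 1) * (1 - x (Fin.last n)) ^ cB p (n + 1) /
        (1 - x (Fin.last n) * delta (fun i : Fin n => x i.castSucc) n) ^ (cC p (n + 1) + 1)) := by
  have hd : delta x (n + 1) = 1 - x (Fin.last n) * delta (fun i : Fin n => x i.castSucc) n := by
    rw [delta_castSucc x le_rfl]
    exact delta_succ x (Fin.last n)
  have hpos := (delta_mem_Ioc hx (le_refl (n + 1))).1
  rw [← hd, integrand, initIntegrand, Fin.prod_univ_castSucc,
    ← Finset.insert_Icc_right_eq_Icc_add_one (show 2 ≤ n + 1 by omega),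
    Finset.prod_insert (by simp), zpow_add_one₀ hpos.ne']
  have hprod : ∏ k ∈ Finset.Icc 2 n, delta (fun i : Fin n => x i.castSucc) k ^ cC p k =
      ∏ k ∈ Finset.Icc 2 n, delta x k ^ cC p k :=
    Finset.prod_congr rfl fun k hk => by rw [delta_castSucc x (Finset.mem_Icc.1 hk).2]
  rw [hprod]
  simp only [Fin.val_castSucc, Fin.val_last]
  have h1 := zpow_pos hpos (cC p (n + 1))
  have h2 := prod_delta_pos (cC p) hx (Nat.le_succ n)
  field_simp

lemma L_eq_lintegral_eulerIntegral (hn : 1 ≤ n) (p : Params (n + 1)) :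
    L (n + 1) p = ∫⁻ y in cube n, ENNReal.ofReal (initIntegrand p y) *
      eulerIntegral (cA p (n + 1)) (cB p (n + 1)) (cC p (n + 1)) (delta y n) := by
  have hmp := volume_preserving_piFinSuccAbove (fun _ : Fin (n + 1) => ℝ) (Fin.last n)
  let F : ℝ × (Fin n → ℝ) → ℝ≥0∞ := fun z => ENNReal.ofReal (initIntegrand p z.2) *
    ENNReal.ofReal (z.1 ^ cA p (n + 1) * (1 - z.1) ^ cB p (n + 1) /
      (1 - z.1 * delta z.2 n) ^ (cC p (n + 1) + 1))
  have hF : Measurable F := by fun_prop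
  have he : ∀ x : Fin (n + 1) → ℝ, MeasurableEquiv.piFinSuccAbove (fun _ : Fin (n + 1) => ℝ)
      (Fin.last n) x = (x (Fin.last n), fun i => x i.castSucc) := fun x => by
    simp [MeasurableEquiv.piFinSuccAbove, Fin.insertNthEquiv]
    rfl
  have hpre : cube (n + 1) = (MeasurableEquiv.piFinSuccAbove (fun _ : Fin (n + 1) => ℝ)
      (Fin.last n)) ⁻¹' (Set.Ioo 0 1 ×ˢ cube n) := by
    ext x
    simp only [mem_cube, Set.mem_preimage, Set.mem_prod, Fin.forall_fin_succ', he]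
    rw [and_comm]
  have h1 : L (n + 1) p = ∫⁻ x in cube (n + 1),
      F (MeasurableEquiv.piFinSuccAbove (fun _ : Fin (n + 1) => ℝ) (Fin.last n) x) := by
    rw [L_eq_lintegral_cube]
    refine setLIntegral_congr_fun measurableSet_cube fun x hx => ?_
    have hy : (fun i : Fin n => x i.castSucc) ∈ cube n :=
      mem_cube.2 fun i => mem_cube.1 hx _
    simp only [F, he]
    rw [integrand_eq hn p hx, ENNReal.ofReal_mul (initIntegrand_pos p hy).le]
  rw [h1, hpre, hmp.setLIntegral_comp_preimage_emb (MeasurableEquiv.measurableEmbedding _),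
    Measure.volume_eq_prod, ← Measure.prod_restrict, lintegral_prod_symm _ hF.aemeasurable]
  refine lintegral_congr fun y => ?_
  simp only [F]
  rw [lintegral_const_mul' _ _ ENNReal.ofReal_ne_top, eulerIntegral]

/-- `χ` changes only the exponents of the inner Euler integral, so Euler's symmetry applies
pointwise under the outer integral. -/
lemma L_chi (hn : 2 ≤ n) {p : Params n} (hp : p ∈ ChiDomain n) :
    L n p = (((cA p n).toNat.factorial * (cB p n).toNat.factorial : ℕ) : ℝ≥0∞) /
          (((cC p n).toNat.factorial * (cA p n + cB p n - cC p n).toNat.factorial : ℕ) : ℝ≥0∞) *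
        L n (chiFun n p) := by
  obtain ⟨m, rfl⟩ := Nat.exists_eq_add_of_le' (show 1 ≤ n by omega)
  obtain ⟨ha, hb, hc, hd⟩ := hp
  have hm : 1 ≤ m := by omega
  rw [L_eq_lintegral_eulerIntegral hm, L_eq_lintegral_eulerIntegral hm, ← lintegral_const_mul' _ _
    (ENNReal.div_ne_top (ENNReal.natCast_ne_top _) (by positivity))]
  refine setLIntegral_congr_fun measurableSet_cube fun y hy => ?_
  have h1 : initIntegrand (chiFun (m + 1) p) y = initIntegrand p y := by
    unfold initIntegrand
    congr 1
    · refine Finset.prod_congr rfl fun i _ => ?_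
      have := i.isLt
      simp only [chiFun, cA_ofCoords, cB_ofCoords]
      grind
    · refine Finset.prod_congr rfl fun k hk => ?_
      rw [Finset.mem_Icc] at hk
      simp only [chiFun, cC_ofCoords]
      grind
  have h2 := eulerIntegral_symm (a := (cA p (m + 1)).toNat) (b := (cB p (m + 1)).toNat)
    (c := (cC p (m + 1)).toNat) (d := (cA p (m + 1) + cB p (m + 1) - cC p (m + 1)).toNat)
    (by omega) (delta_mem_Ioo hy hm le_rfl)
  rw [Int.toNat_of_nonneg ha, Int.toNat_of_nonneg hb, Int.toNat_of_nonneg hc,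
    Int.toNat_of_nonneg hd] at h2
  have e1 : cA (chiFun (m + 1) p) (m + 1) = cC p (m + 1) := by simp [chiFun, cA_ofCoords]
  have e2 : cB (chiFun (m + 1) p) (m + 1) = cA p (m + 1) + cB p (m + 1) - cC p (m + 1) := by
    simp [chiFun, cB_ofCoords]
  have e3 : cC (chiFun (m + 1) p) (m + 1) = cA p (m + 1) := by
    simp [chiFun, cC_ofCoords]; omega
  rw [h1, e1, e2, e3, h2]
  ring

/-- The inner integral diverges at every point of a cube of positive measure, where the other factor
is positive. -/
lemma L_eq_top (hn : 2 ≤ n) {p : Params n} (hp : cA p n < 0 ∨ cB p n < 0) : L n p = ∞ := by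
  obtain ⟨m, rfl⟩ := Nat.exists_eq_add_of_le' (show 1 ≤ n by omega)
  have hm : 1 ≤ m := by omega
  rw [L_eq_lintegral_eulerIntegral hm]
  have h1 : ∀ y ∈ cube m, ENNReal.ofReal (initIntegrand p y) *
      eulerIntegral (cA p (m + 1)) (cB p (m + 1)) (cC p (m + 1)) (delta y m) = ∞ := by
    intro y hy
    have hz := delta_mem_Ioo hy hm le_rfl
    have h2 : eulerIntegral (cA p (m + 1)) (cB p (m + 1)) (cC p (m + 1)) (delta y m) = ∞ := by
      rcases hp with hp | hp
      · exact eulerIntegral_eq_top_left _ _ hz hp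
      · exact eulerIntegral_eq_top_right _ _ hz hp
    rw [h2, ENNReal.mul_top (ENNReal.ofReal_pos.2 (initIntegrand_pos p hy)).ne']
  rw [setLIntegral_congr_fun measurableSet_cube h1, setLIntegral_const, volume_cube, mul_one]

/-! ### The invariance under `σ` -/

/-- The substitution which exchanges `x_1` with `1 - x_2`. -/
def sigmaSubst (n : ℕ) (x : Fin (n + 2) → ℝ) : Fin (n + 2) → ℝ :=
  fun i => if i = 0 then 1 - x 1 else if i = 1 then 1 - x 0 else x i

lemma measurePreserving_sigmaSubst (n : ℕ) : MeasurePreserving (sigmaSubst n) := by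
  have h1 := volume_measurePreserving_piCongrLeft (fun _ : Fin (n + 2) => ℝ) (Equiv.swap 0 1)
  have h2 : MeasurePreserving (fun (x : Fin (n + 2) → ℝ) i =>
      (if i = 0 ∨ i = 1 then fun t : ℝ => 1 - t else id) (x i)) := by
    refine volume_preserving_pi fun i => ?_
    split_ifs
    · exact Measure.measurePreserving_sub_left volume 1
    · exact MeasurePreserving.id _
  refine (?_ : sigmaSubst n = _) ▸ h2.comp h1
  funext x i
  have h3 : MeasurableEquiv.piCongrLeft (fun _ : Fin (n + 2) => ℝ) (Equiv.swap 0 1) x i =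
      x (Equiv.swap 0 1 i) := by
    obtain ⟨j, rfl⟩ := (Equiv.swap (0 : Fin (n + 2)) 1).surjective i
    rw [MeasurableEquiv.coe_piCongrLeft, Equiv.piCongrLeft_apply_apply, Equiv.swap_apply_self]
  simp only [Function.comp_apply, h3, sigmaSubst]
  by_cases hi0 : i = 0
  · simp [hi0]
  · by_cases hi1 : i = 1
    · simp [hi1]
    · simp [hi0, hi1, Equiv.swap_apply_of_ne_of_ne]

/-- From `k = 2` on, the recursion sees `x_1, x_2` only through `δ_2`. `δ_1` does change, but it
carries no exponent since the `c_k` start at `k = 2`. -/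
lemma delta_sigmaSubst (x : Fin (n + 2) → ℝ) {k : ℕ} (hk : 2 ≤ k) :
    delta (sigmaSubst n x) k = delta x k := by
  induction k, hk using Nat.le_induction with
  | base => simp [delta, sigmaSubst]; ring
  | succ k hk ih =>
    rw [delta, delta, ih]
    split_ifs with h
    · have h0 : (⟨k, h⟩ : Fin (n + 2)) ≠ 0 := by simp [Fin.ext_iff]; omega
      have h1 : (⟨k, h⟩ : Fin (n + 2)) ≠ 1 := by simp [Fin.ext_iff]; omega
      simp [sigmaSubst, h0, h1]
    · rfl

lemma L_sigma (hn : 2 ≤ n) (p : Params n) : L n (sigmaFun n p) = L n p := by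
  obtain ⟨m, rfl⟩ := Nat.exists_eq_add_of_le' hn
  have hpre : sigmaSubst m ⁻¹' cube (m + 2) = cube (m + 2) := by
    ext x
    simp only [Set.mem_preimage, mem_cube, Fin.forall_fin_succ, sigmaSubst, Set.mem_Ioo]
    simp
    grind
  rw [L_eq_lintegral_cube, ← (measurePreserving_sigmaSubst m).setLIntegral_comp_preimage
    measurableSet_cube (by fun_prop), hpre, L_eq_lintegral_cube]
  refine setLIntegral_congr_fun measurableSet_cube fun x hx => ?_
  congr 1
  unfold integrand
  rw [delta_sigmaSubst x hn]
  congr 2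
  · rw [Fin.prod_univ_succ, Fin.prod_univ_succ, Fin.prod_univ_succ (n := m + 1),
      Fin.prod_univ_succ (n := m)]
    refine (mul_assoc _ _ _).symm.trans (Eq.trans ?_ (mul_assoc _ _ _))
    congr 1
    · simp [sigmaSubst, sigmaFun, cA_ofCoords, cB_ofCoords]
      ring
    · refine Finset.prod_congr rfl fun i _ => ?_
      have := i.isLt
      simp [sigmaSubst, sigmaFun, cA_ofCoords, cB_ofCoords, Fin.ext_iff]
  · refine Finset.prod_congr rfl fun k hk => ?_
    rw [Finset.mem_Icc] at hk
    rw [delta_sigmaSubst x hk.1]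
    simp [sigmaFun, cC_ofCoords, hk]

/-! ### The invariance under `ψ` -/

/-- The sequence `1, d_1, …, d_n`, continued by zeros. -/
def extend (d : Fin n → ℝ) : ℕ → ℝ
  | 0 => 1
  | k + 1 => if h : k < n then d ⟨k, h⟩ else 0

lemma extend_succ (d : Fin n → ℝ) (i : Fin n) : extend d (i + 1) = d i := by
  simp [extend]

/-- The point `x` of the cube such that `δ_k(x) = d_k` for all `k`. -/
noncomputable def ofDelta (d : Fin n → ℝ) : Fin n → ℝ := fun i => (1 - d i) / extend d i

/-- The values of `(δ_1, …, δ_n)` on the open cube. -/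
def deltaRegion (n : ℕ) : Set (Fin n → ℝ) :=
  {d | ∀ i : Fin n, 0 < d i ∧ d i < 1 ∧ 1 < extend d i + d i}

@[fun_prop]
lemma measurable_extend (k : ℕ) : Measurable fun d : Fin n → ℝ => extend d k := by
  cases k with
  | zero => exact measurable_const
  | succ k =>
    simp only [extend]
    split_ifs <;> fun_prop

lemma measurableSet_deltaRegion : MeasurableSet (deltaRegion n) := by
  have h : deltaRegion n = ⋂ i : Fin n, {d : Fin n → ℝ | 0 < d i} ∩
      ({d : Fin n → ℝ | d i < 1} ∩ {d : Fin n → ℝ | 1 < extend d i + d i}) := by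
    ext d
    simp [deltaRegion]
  rw [h]
  exact MeasurableSet.iInter fun i =>
    (measurableSet_lt measurable_const (measurable_pi_apply i)).inter
      ((measurableSet_lt (measurable_pi_apply i) measurable_const).inter
        (measurableSet_lt measurable_const (by fun_prop)))

lemma extend_pos {d : Fin n → ℝ} (hd : d ∈ deltaRegion n) {k : ℕ} (hk : k ≤ n) :
    0 < extend d k := by
  cases k with
  | zero => exact one_pos
  | succ k =>
    rw [extend_succ d ⟨k, hk⟩]
    exact (hd _).1

lemma delta_ofDelta {d : Fin n → ℝ} (hd : d ∈ deltaRegion n) {k : ℕ} (hk : k ≤ n) :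
    delta (ofDelta d) k = extend d k := by
  induction k with
  | zero => rfl
  | succ k ih =>
    have := extend_pos hd (k := k) (by omega)
    rw [delta_succ _ ⟨k, hk⟩, extend_succ d ⟨k, hk⟩, ih (by omega), ofDelta]
    field_simp
    ring

lemma injOn_ofDelta : Set.InjOn (ofDelta (n := n)) (deltaRegion n) := by
  intro d hd d' hd' h
  funext i
  rw [← extend_succ d, ← extend_succ d', ← delta_ofDelta hd i.isLt, ← delta_ofDelta hd' i.isLt, h]

lemma extend_delta (x : Fin n → ℝ) {k : ℕ} (hk : k ≤ n) :
    extend (fun i : Fin n => delta x (i + 1)) k = delta x k := by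
  cases k with
  | zero => rfl
  | succ k => rw [extend_succ _ ⟨k, hk⟩]

/-- With `x_k = (1 - d_k)/d_{k-1}`, the condition `x_k > 0` means `d_k < 1`, and `x_k < 1` means
`d_{k-1} + d_k > 1`. -/
lemma image_ofDelta : ofDelta '' deltaRegion n = cube n := by
  ext x
  rw [mem_cube]
  constructor
  · rintro ⟨d, hd, rfl⟩ i
    obtain ⟨h1, h2, h3⟩ := hd i
    have h4 := extend_pos hd i.isLt.le
    refine ⟨div_pos (by linarith) h4, (div_lt_one h4).2 (by linarith)⟩
  · intro hx
    have hd : ∀ i : Fin n, 0 < delta x (i + 1) ∧ delta x (i + 1) < 1 ∧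
        1 < delta x i + delta x (i + 1) := fun i => by
      have h1 := delta_mem_Ioo (mem_cube.2 hx) (k := i + 1) (by omega) i.isLt
      have h2 := (delta_mem_Ioc (mem_cube.2 hx) i.isLt.le).1
      refine ⟨h1.1, h1.2, ?_⟩
      rw [delta_succ]
      have := hx i
      nlinarith [this.1, this.2]
    refine ⟨fun i => delta x (i + 1), fun i => ?_, ?_⟩
    · rw [extend_delta x i.isLt.le]
      exact hd i
    · funext i
      have h2 := (delta_mem_Ioc (mem_cube.2 hx) i.isLt.le).1
      rw [ofDelta, extend_delta x i.isLt.le, delta_succ]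
      field_simp
      ring

/-- The derivative of `d ↦ extend d k`. -/
noncomputable def extendDeriv (n : ℕ) : ℕ → ((Fin n → ℝ) →L[ℝ] ℝ)
  | 0 => 0
  | k + 1 => if h : k < n then ContinuousLinearMap.proj ⟨k, h⟩ else 0

lemma hasFDerivAt_extend (d : Fin n → ℝ) (k : ℕ) :
    HasFDerivAt (fun d : Fin n → ℝ => extend d k) (extendDeriv n k) d := by
  cases k with
  | zero => exact hasFDerivAt_const _ _
  | succ k =>
    simp only [extend, extendDeriv]
    split_ifs with h
    · exact hasFDerivAt_apply _ _
    · exact hasFDerivAt_const _ _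

/-- Owing to the shift, `extend d i` is the coordinate of `Fin` index `i - 1` (or the constant 1).
Hence the Jacobian matrix is lower triangular. -/
lemma extendDeriv_single {i j : Fin n} (h : i ≤ j) : extendDeriv n i (Pi.single j 1) = 0 := by
  obtain ⟨i, hi⟩ := i
  cases i with
  | zero => rfl
  | succ i =>
    have h1 : (⟨i, by omega⟩ : Fin n) ≠ j := by
      intro hj
      have h2 : i + 1 ≤ (j : ℕ) := h
      rw [← hj] at h2
      exact absurd h2 (by simp)
    simp [extendDeriv, show i < n by omega, h1]

/-- The derivative of `ofDelta`. -/
noncomputable def ofDeltaDeriv (d : Fin n → ℝ) : (Fin n → ℝ) →L[ℝ] (Fin n → ℝ) :=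
  ContinuousLinearMap.pi fun i => -((extend d i)⁻¹ • ContinuousLinearMap.proj i) -
    ((1 - d i) / extend d i ^ 2) • extendDeriv n i

lemma hasFDerivAt_ofDelta {d : Fin n → ℝ} (hd : d ∈ deltaRegion n) :
    HasFDerivAt ofDelta (ofDeltaDeriv d) d := by
  rw [hasFDerivAt_pi']
  intro i
  have h := extend_pos hd i.isLt.le
  have h1 := ((hasFDerivAt_apply (𝕜 := ℝ) i d).const_sub 1).mul
    ((hasDerivAt_inv h.ne').comp_hasFDerivAt d (hasFDerivAt_extend d i))
  refine h1.congr_fderiv ?_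
  ext v
  simp [ofDeltaDeriv]
  ring

lemma det_ofDeltaDeriv (d : Fin n → ℝ) :
    (ofDeltaDeriv d).det = ∏ i : Fin n, -(extend d i)⁻¹ := by
  rw [ContinuousLinearMap.det, ← LinearMap.det_toMatrix', Matrix.det_of_isLowerTriangular]
  · refine Finset.prod_congr rfl fun i _ => ?_
    rw [LinearMap.toMatrix'_apply]
    simp [ofDeltaDeriv, extendDeriv_single le_rfl]
  · intro i j hij
    have hij' : i < j := hij
    rw [LinearMap.toMatrix'_apply]
    simp [ofDeltaDeriv, extendDeriv_single hij'.le, hij'.ne]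

/-- The exponent of `d_k` in the integrand of `L p` after the substitution `d_k = δ_k(x)`. -/
def deltaExponent (p : Params n) (k : ℕ) : ℤ :=
  (if k = 1 then cB p 1 else 0) - cA p (k + 1) - cB p (k + 1) - cC p k - 1

/-- The integrand of `L p` after the substitution `d_k = δ_k(x)`. -/
noncomputable def deltaIntegrand (p : Params n) (d : Fin n → ℝ) : ℝ :=
  (∏ k ∈ Finset.range n, (1 - extend d (k + 1)) ^ cA p (k + 1) *
    extend d (k + 1) ^ deltaExponent p (k + 1)) *
  ∏ k ∈ Finset.range (n - 1), (extend d (k + 1) + extend d (k + 2) - 1) ^ cB p (k + 2)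

lemma det_mul_integrand (hn : 1 ≤ n) (p : Params n) {d : Fin n → ℝ} (hd : d ∈ deltaRegion n) :
    |(ofDeltaDeriv d).det| * integrand p (ofDelta d) = deltaIntegrand p d := by
  have hpos : ∀ k, k ≤ n → 0 < extend d k := fun k hk => extend_pos hd hk
  have hdet : |(ofDeltaDeriv d).det| = ∏ k ∈ Finset.range n, (extend d k)⁻¹ := by
    rw [det_ofDeltaDeriv, Finset.abs_prod, ← Fin.prod_univ_eq_prod_range]
    refine Finset.prod_congr rfl fun i _ => ?_
    rw [abs_neg, abs_of_pos (inv_pos.2 (hpos i i.isLt.le))]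
  -- The Jacobian contributes `1/(d_0 ⋯ d_{n-1})` with `d_0 = 1`, and `1/δ_n` completes it to
  -- `1/(d_1 ⋯ d_n)`: this is the `-1` in `deltaExponent`.
  have hinv : (∏ k ∈ Finset.range n, (extend d k)⁻¹) * (extend d n)⁻¹ =
      ∏ k ∈ Finset.range n, (extend d (k + 1))⁻¹ := by
    rw [← Finset.prod_range_succ, Finset.prod_range_succ']
    simp [extend]
  -- The boundary terms of the shift vanish: `d_0 = 1`, and `a_{n+1}`, `b_{n+1}` have default value
  -- 0.
  have hshift : ∏ k ∈ Finset.range n, extend d k ^ (-(cA p (k + 1) + cB p (k + 1))) =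
      ∏ k ∈ Finset.range n, extend d (k + 1) ^ (-(cA p (k + 2) + cB p (k + 2))) := by
    have h1 := Finset.prod_range_succ (fun k => extend d k ^ (-(cA p (k + 1) + cB p (k + 1)))) n
    rw [Finset.prod_range_succ'] at h1
    have h2 : cA p (n + 1) = 0 := by simp [cA]
    have h3 : cB p (n + 1) = 0 := by simp [cB]
    simpa [h2, h3, extend] using h1.symm
  have hc : (∏ k ∈ Finset.Icc 2 n, delta (ofDelta d) k ^ cC p k) =
      ∏ k ∈ Finset.range n, extend d (k + 1) ^ cC p (k + 1) := by
    obtain ⟨m, rfl⟩ := Nat.exists_eq_add_of_le' hn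
    rw [Finset.prod_range_succ', show cC p (0 + 1) = 0 by simp [cC], zpow_zero, mul_one]
    rw [← Finset.Ico_add_one_right_eq_Icc, Finset.prod_Ico_eq_prod_range]
    refine Finset.prod_congr (by congr 1) fun k hk => ?_
    rw [Finset.mem_range] at hk
    rw [delta_ofDelta hd (by omega), show 2 + k = k + 1 + 1 by ring]
  -- The factor with `k = 0` is `d_0 + d_1 - 1 = d_1`, so `b_1` joins the exponent of `d_1`.
  have hb : ∏ k ∈ Finset.range n, (extend d k + extend d (k + 1) - 1) ^ cB p (k + 1) =
      (∏ k ∈ Finset.range (n - 1), (extend d (k + 1) + extend d (k + 2) - 1) ^ cB p (k + 2)) *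
        ∏ k ∈ Finset.range n, extend d (k + 1) ^ (if k + 1 = 1 then cB p 1 else 0) := by
    obtain ⟨m, rfl⟩ := Nat.exists_eq_add_of_le' hn
    rw [Finset.prod_range_succ', Finset.prod_range_succ' _ m]
    simp [extend]
  have ha : (∏ i : Fin n, ofDelta d i ^ cA p (i + 1) * (1 - ofDelta d i) ^ cB p (i + 1)) =
      (∏ k ∈ Finset.range n, (1 - extend d (k + 1)) ^ cA p (k + 1)) *
      (∏ k ∈ Finset.range n, (extend d k + extend d (k + 1) - 1) ^ cB p (k + 1)) *
      ∏ k ∈ Finset.range n, extend d k ^ (-(cA p (k + 1) + cB p (k + 1))) := by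
    rw [← Finset.prod_mul_distrib, ← Finset.prod_mul_distrib, ← Fin.prod_univ_eq_prod_range
      (fun k => (1 - extend d (k + 1)) ^ cA p (k + 1) *
        (extend d k + extend d (k + 1) - 1) ^ cB p (k + 1) *
        extend d k ^ (-(cA p (k + 1) + cB p (k + 1))))]
    refine Finset.prod_congr rfl fun i _ => ?_
    have h0 := hpos i i.isLt.le
    rw [extend_succ, ofDelta, show 1 - (1 - d i) / extend d i =
      (extend d i + d i - 1) / extend d i by field_simp; ring, div_zpow, div_zpow, zpow_neg,
      zpow_add₀ h0.ne']
    have h1 := zpow_pos h0 (cA p (i + 1))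
    have h2 := zpow_pos h0 (cB p (i + 1))
    field_simp
  have hexp : ∏ k ∈ Finset.range n, extend d (k + 1) ^ deltaExponent p (k + 1) =
      (∏ k ∈ Finset.range n, extend d (k + 1) ^ (if k + 1 = 1 then cB p 1 else 0)) *
      (∏ k ∈ Finset.range n, extend d (k + 1) ^ (-(cA p (k + 2) + cB p (k + 2)))) *
      (∏ k ∈ Finset.range n, extend d (k + 1) ^ cC p (k + 1))⁻¹ *
      ∏ k ∈ Finset.range n, (extend d (k + 1))⁻¹ := by
    rw [← Finset.prod_inv_distrib, ← Finset.prod_mul_distrib, ← Finset.prod_mul_distrib,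
      ← Finset.prod_mul_distrib]
    refine Finset.prod_congr rfl fun k hk => ?_
    have h0 := hpos (k + 1) (Finset.mem_range.1 hk)
    rw [← zpow_neg, ← zpow_neg_one (extend d (k + 1)), ← zpow_add₀ h0.ne', ← zpow_add₀ h0.ne',
      ← zpow_add₀ h0.ne', deltaExponent]
    congr 1
    ring
  rw [deltaIntegrand, Finset.prod_mul_distrib, hexp, ← hinv, ← hshift, integrand, hc, ha, hb, hdet,
    delta_ofDelta hd le_rfl]
  ring

lemma L_eq_lintegral_deltaIntegrand (hn : 1 ≤ n) (p : Params n) :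
    L n p = ∫⁻ d in deltaRegion n, ENNReal.ofReal (deltaIntegrand p d) := by
  rw [L_eq_lintegral_cube, ← image_ofDelta, lintegral_image_eq_lintegral_abs_det_fderiv_mul volume
    measurableSet_deltaRegion (fun d hd => (hasFDerivAt_ofDelta hd).hasFDerivWithinAt)
    injOn_ofDelta]
  refine setLIntegral_congr_fun measurableSet_deltaRegion fun d hd => ?_
  rw [← ENNReal.ofReal_mul (abs_nonneg _), det_mul_integrand hn p hd]

lemma extend_rev (d : Fin n → ℝ) {k : ℕ} (h1 : 1 ≤ k) (h2 : k ≤ n) :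
    extend (fun i => d i.rev) k = extend d (n + 1 - k) := by
  obtain ⟨k, rfl⟩ := Nat.exists_eq_add_of_le' h1
  rw [extend_succ _ ⟨k, h2⟩, ← extend_succ d]
  congr 1
  simp [Fin.rev]
  omega

/-- These equations, solved for the new `b_1` and `c_k`, are what dictates the formula for `ψ`. The
default values `a_{n+1} = b_{n+1} = c_1 = 0` cover the two ends. -/
lemma deltaExponent_psi (hn : 3 ≤ n) (p : Params n) {k : ℕ} (h1 : 1 ≤ k) (h2 : k ≤ n) :
    deltaExponent (psiFun n p) k = deltaExponent p (n + 1 - k) := by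
  simp only [deltaExponent, psiFun, cA_ofCoords, cB_ofCoords, cC_ofCoords]
  have e1 : cA p (n + 1) = 0 := by simp [cA]
  have e2 : cB p (n + 1) = 0 := by simp [cB]
  have e3 : cC p 1 = 0 := by simp [cC]
  grind (splits := 20)

lemma deltaIntegrand_psi (hn : 3 ≤ n) (p : Params n) (d : Fin n → ℝ) :
    deltaIntegrand (psiFun n p) (fun i => d i.rev) = deltaIntegrand p d := by
  unfold deltaIntegrand
  congr 1
  · rw [← Finset.prod_range_reflect]
    refine Finset.prod_congr rfl fun k hk => ?_
    rw [Finset.mem_range] at hk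
    have e : n + 1 - (n - 1 - k + 1) = k + 1 := by omega
    rw [extend_rev d (by omega) (by omega), deltaExponent_psi hn p (by omega) (by omega), e]
    congr 2
    simp only [psiFun, cA_ofCoords]
    grind
  · rw [← Finset.prod_range_reflect]
    refine Finset.prod_congr rfl fun k hk => ?_
    rw [Finset.mem_range] at hk
    have e1 : n + 1 - (n - 1 - 1 - k + 1) = k + 2 := by omega
    have e2 : n + 1 - (n - 1 - 1 - k + 2) = k + 1 := by omega
    rw [extend_rev d (by omega) (by omega), extend_rev d (by omega) (by omega), e1, e2,
      add_comm (extend d (k + 2))]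
    congr 1
    simp only [psiFun, cB_ofCoords]
    grind

lemma rev_mem_deltaRegion {d : Fin n → ℝ} (hd : d ∈ deltaRegion n) :
    (fun i => d i.rev) ∈ deltaRegion n := by
  intro i
  refine ⟨(hd i.rev).1, (hd i.rev).2.1, ?_⟩
  obtain ⟨i, hi⟩ := i
  cases i with
  -- The first condition is empty because `d_0 = 1`; the others are symmetric in neighbouring
  -- coordinates.
  | zero => exact lt_add_of_pos_right 1 (hd _).1
  | succ i =>
    have h := (hd ⟨n - 1 - i, by omega⟩).2.2
    have h1 : extend (fun i => d i.rev) (i + 1) = d ⟨n - 1 - i, by omega⟩ := by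
      rw [extend_succ _ ⟨i, by omega⟩]
      exact congrArg d (Fin.ext (by simp [Fin.rev]; omega))
    have h2 : extend d (n - 1 - i) = d (Fin.rev ⟨i + 1, hi⟩) := by
      rw [← extend_succ d]
      congr 1
      simp [Fin.rev]
      omega
    change 1 < extend (fun i => d i.rev) (i + 1) + d (Fin.rev ⟨i + 1, hi⟩)
    rw [h1, ← h2, add_comm]
    exact h

lemma L_psi (hn : 3 ≤ n) (p : Params n) : L n (psiFun n p) = L n p := by
  have hmp := volume_measurePreserving_piCongrLeft (fun _ : Fin n => ℝ) Fin.revPerm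
  have he : ∀ d : Fin n → ℝ, MeasurableEquiv.piCongrLeft (fun _ : Fin n => ℝ) Fin.revPerm d =
      fun i => d i.rev := fun d => by
    funext i
    obtain ⟨j, rfl⟩ := (Fin.revPerm (n := n)).surjective i
    rw [MeasurableEquiv.coe_piCongrLeft, Equiv.piCongrLeft_apply_apply, Fin.revPerm_apply,
      Fin.rev_rev]
  have hpre : MeasurableEquiv.piCongrLeft (fun _ : Fin n => ℝ) Fin.revPerm ⁻¹' deltaRegion n =
      deltaRegion n := by
    ext d
    rw [Set.mem_preimage, he]
    refine ⟨fun h => ?_, rev_mem_deltaRegion⟩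
    simpa using rev_mem_deltaRegion h
  rw [L_eq_lintegral_deltaIntegrand (by omega), L_eq_lintegral_deltaIntegrand (by omega),
    ← hmp.setLIntegral_comp_preimage_emb (MeasurableEquiv.measurableEmbedding _), hpre]
  simp only [he, deltaIntegrand_psi hn]

/-! ### Rationality of the quotients -/

lemma RationalRatio.refl {x : ℝ≥0∞} (hx : x ≠ 0) : RationalRatio x x := by
  by_cases h : x = ∞
  · exact Or.inl ⟨h, h⟩
  · exact Or.inr ⟨h, h, 1, one_ne_zero, by
      rw [div_self (ENNReal.toReal_ne_zero.2 ⟨hx, h⟩), Rat.cast_one]⟩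

lemma RationalRatio.symm {x y : ℝ≥0∞} (h : RationalRatio x y) : RationalRatio y x := by
  rcases h with ⟨hx, hy⟩ | ⟨hx, hy, q, hq, h⟩
  · exact Or.inl ⟨hy, hx⟩
  · exact Or.inr ⟨hy, hx, q⁻¹, inv_ne_zero hq, by rw [Rat.cast_inv, ← h, inv_div]⟩

lemma RationalRatio.trans {x y z : ℝ≥0∞} (h : RationalRatio x y) (h' : RationalRatio y z) :
    RationalRatio x z := by
  rcases h with ⟨hx, hy⟩ | ⟨hx, hy, q, hq, h⟩ <;>
    rcases h' with ⟨hy', hz⟩ | ⟨hy', hz, q', hq', h'⟩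
  · exact Or.inl ⟨hx, hz⟩
  · exact absurd hy hy'
  · exact absurd hy' hy
  · have hy0 : y.toReal ≠ 0 := fun h0 => hq (by simpa [h0] using h.symm)
    refine Or.inr ⟨hx, hz, q * q', mul_ne_zero hq hq', ?_⟩
    rw [Rat.cast_mul, ← h, ← h', div_mul_div_cancel₀ hy0]

lemma rationalRatio_mul_left {a b : ℕ} (ha : a ≠ 0) (hb : b ≠ 0) {x : ℝ≥0∞} (hx : x ≠ 0) :
    RationalRatio ((a : ℝ≥0∞) / b * x) x := by
  have hab : (a : ℝ≥0∞) / b ≠ 0 := by simp [ha]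
  have hab' : (a : ℝ≥0∞) / b ≠ ∞ := ENNReal.div_ne_top (ENNReal.natCast_ne_top _) (by simpa)
  by_cases h : x = ∞
  · exact Or.inl ⟨by rw [h, ENNReal.mul_top hab], h⟩
  · refine Or.inr ⟨ENNReal.mul_ne_top hab' h, h, (a : ℚ) / b, by positivity, ?_⟩
    rw [ENNReal.toReal_mul, mul_div_cancel_right₀ _ (ENNReal.toReal_ne_zero.2 ⟨hx, h⟩)]
    simp

lemma rationalRatio_chi (hn : 2 ≤ n) {p : Params n} (hp : p ∈ ChiDomain n) :
    RationalRatio (L n (chiFun n p)) (L n p) := by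
  rw [L_chi hn hp]
  exact (rationalRatio_mul_left (by positivity) (by positivity) (L_pos _).ne').symm

lemma admissible_comp_iff {g : Params n → Params n} {π : Fin 8 → Fin 8}
    (hπ : Function.Surjective π) (hg : ∀ p, forms (g p) = forms p ∘ π) (p : Params n) :
    g p ∈ Admissible n ↔ p ∈ Admissible n := by
  simp only [mem_Admissible_iff, hg, Function.comp_apply]
  exact (hπ.forall (p := fun i => 0 ≤ forms p i)).symm

/-- Stability is proved together with rationality, so that each intermediate point of a word in the
generators is admissible and the relation for `χ` is available there. -/
lemma admissible_and_rationalRatio (hn : 3 ≤ n) {g : GLZ (Index n)}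
    (hg : g ∈ group n (Nat.le_of_succ_le hn)) : ∀ p : Params n,
      (g p ∈ Admissible n ↔ p ∈ Admissible n) ∧
      (p ∈ Admissible n → RationalRatio (L n (g p)) (L n p)) := by
  induction hg using Subgroup.closure_induction with
  | mem g hg =>
    intro p
    rcases hg with rfl | rfl | rfl
    · exact ⟨admissible_comp_iff (by decide) (forms_sigma hn) p, fun _ => by
        rw [sigma_apply, L_sigma (by omega)]; exact .refl (L_pos _).ne'⟩
    · exact ⟨admissible_comp_iff (by decide) (forms_psi hn) p, fun _ => by
        rw [psi_apply, L_psi hn]; exact .refl (L_pos _).ne'⟩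
    · exact ⟨admissible_comp_iff (by decide) (forms_chi hn) p, fun hp =>
        rationalRatio_chi (by omega) hp.1⟩
  | one => exact fun p => ⟨Iff.rfl, fun _ => .refl (L_pos _).ne'⟩
  | mul g h _ _ ihg ihh =>
    intro p
    rw [LinearEquiv.mul_apply]
    exact ⟨(ihg _).1.trans (ihh _).1, fun hp =>
      ((ihg _).2 ((ihh _).1.2 hp)).trans ((ihh _).2 hp)⟩
  | inv g _ ih =>
    intro p
    have h := ih (g⁻¹ p)
    rw [← LinearEquiv.mul_apply, mul_inv_cancel, LinearEquiv.coe_one, id_eq] at h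
    exact ⟨h.1.symm, fun hp => (h.2 (h.1.1 hp)).symm⟩

/-- Up to the invariance of `L` under `σ` and `ψ`, there are four elements in the group. -/
lemma L_apply_mem_group (hn : 3 ≤ n) {g : GLZ (Index n)}
    (hg : g ∈ group n (Nat.le_of_succ_le hn)) :
    (∀ p, L n (g p) = L n p) ∨ (∀ p, L n (g p) = L n (chiFun n p)) ∨
      (∀ p, L n (g p) = L n (chiConjFun n p)) ∨
      (∀ p, L n (g p) = L n (chiFun n (chiConjFun n p))) := by
  have hσ : ∀ p : Params n, L n (sigmaFun n p) = L n p := L_sigma (by omega)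
  have hψ : ∀ p : Params n, L n (psiFun n p) = L n p := L_psi hn
  have hψψ : ∀ p : Params n, psiFun n (psiFun n p) = p := fun p =>
    LinearEquiv.congr_fun (psi_mul_self (Nat.le_of_succ_le hn)) p
  have hχχ : ∀ p : Params n, chiFun n (chiFun n p) = p := fun p =>
    LinearEquiv.congr_fun (chi_mul_self (Nat.le_of_succ_le hn)) p
  have hχψ : ∀ p : Params n, chiFun n (psiFun n p) = psiFun n (chiConjFun n p) := fun p => by
    rw [← psiFun_chiFun_psiFun hn, hψψ]
  have hχ'ψ : ∀ p : Params n, chiConjFun n (psiFun n p) = psiFun n (chiFun n p) := fun p => by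
    rw [← psiFun_chiFun_psiFun hn, hψψ]
  -- The four functions are stable under composition on the right with a generator: `σ` commutes
  -- with `χ` and its conjugate, `ψ` exchanges these two, and they commute.
  have step : ∀ x : GLZ (Index n), ∀ y ∈ ({sigma n (Nat.le_of_succ_le hn),
      psi n (Nat.le_of_succ_le hn), chi n (Nat.le_of_succ_le hn)} : Set (GLZ (Index n))),
      ((∀ p, L n (x p) = L n p) ∨ (∀ p, L n (x p) = L n (chiFun n p)) ∨
        (∀ p, L n (x p) = L n (chiConjFun n p)) ∨
        (∀ p, L n (x p) = L n (chiFun n (chiConjFun n p)))) →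
      ((∀ p, L n ((x * y) p) = L n p) ∨ (∀ p, L n ((x * y) p) = L n (chiFun n p)) ∨
        (∀ p, L n ((x * y) p) = L n (chiConjFun n p)) ∨
        (∀ p, L n ((x * y) p) = L n (chiFun n (chiConjFun n p)))) := by
    rintro x y (rfl | rfl | rfl) h
    · simp only [LinearEquiv.mul_apply, sigma_apply]
      rcases h with h | h | h | h
      · exact Or.inl fun p => by rw [h, hσ]
      · exact Or.inr (Or.inl fun p => by rw [h, ← sigmaFun_chiFun hn, hσ])
      · exact Or.inr (Or.inr (Or.inl fun p => by rw [h, ← sigmaFun_chiConjFun hn, hσ]))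
      · exact Or.inr (Or.inr (Or.inr fun p => by
          rw [h, ← sigmaFun_chiConjFun hn, ← sigmaFun_chiFun hn, hσ]))
    · simp only [LinearEquiv.mul_apply, psi_apply]
      rcases h with h | h | h | h
      · exact Or.inl fun p => by rw [h, hψ]
      · exact Or.inr (Or.inr (Or.inl fun p => by rw [h, hχψ, hψ]))
      · exact Or.inr (Or.inl fun p => by rw [h, hχ'ψ, hψ])
      · exact Or.inr (Or.inr (Or.inr fun p => by
          rw [h, hχ'ψ, hχψ, hψ, chiFun_chiConjFun hn]))
    · simp only [LinearEquiv.mul_apply, chi_apply]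
      rcases h with h | h | h | h
      · exact Or.inr (Or.inl fun p => h _)
      · exact Or.inl fun p => by rw [h, hχχ]
      · exact Or.inr (Or.inr (Or.inr fun p => by rw [h, chiFun_chiConjFun hn]))
      · exact Or.inr (Or.inr (Or.inl fun p => by rw [h, ← chiFun_chiConjFun hn, hχχ]))
  induction hg using Subgroup.closure_induction_right with
  | one => exact Or.inl fun p => rfl
  | mul_right x _ y hy ih => exact step x y hy ih
  | mul_inv_cancel x _ y hy ih =>
    have hinv : y⁻¹ = y := by
      rcases hy with rfl | rfl | rfl
      · exact inv_eq_of_mul_eq_one_left (sigma_mul_self _)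
      · exact inv_eq_of_mul_eq_one_left (psi_mul_self _)
      · exact inv_eq_of_mul_eq_one_left (chi_mul_self _)
    rw [hinv]
    exact step x y hy ih

lemma nonneg_of_L_ne_top (hn : 2 ≤ n) {p : Params n} (hp : L n p ≠ ∞) :
    0 ≤ cA p n ∧ 0 ≤ cB p n := by
  by_contra h
  exact hp (L_eq_top hn (by omega))

lemma mem_ChiDomain_iff (p : Params n) : p ∈ ChiDomain n ↔
    0 ≤ forms p 0 ∧ 0 ≤ forms p 1 ∧ 0 ≤ forms p 2 ∧ 0 ≤ forms p 3 := Iff.rfl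

/-- If `L p` is finite, then four of the eight forms are nonnegative at `p`. -/
lemma forms_nonneg_of_L_ne_top (hn : 3 ≤ n) {p : Params n} (hp : L n p ≠ ∞) :
    0 ≤ forms p 0 ∧ 0 ≤ forms p 1 ∧ 0 ≤ forms p 4 ∧ 0 ≤ forms p 5 := by
  have h1 := nonneg_of_L_ne_top (by omega) hp
  rw [← L_psi hn] at hp
  have h2 : 0 ≤ forms (psiFun n p) 0 ∧ 0 ≤ forms (psiFun n p) 1 :=
    nonneg_of_L_ne_top (by omega) hp
  rw [forms_psiFun hn] at h2
  exact ⟨h1.1, h1.2, h2.1, h2.2⟩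

/-- Finiteness at `p` gives `a_n, b_n ≥ 0`; finiteness at `χ(p)` gives the other two conditions of
`ChiDomain`. -/
lemma rationalRatio_chi_of_ne_top (hn : 3 ≤ n) {p : Params n} (h : L n p ≠ ∞)
    (h' : L n (chiFun n p) ≠ ∞) : RationalRatio (L n (chiFun n p)) (L n p) := by
  obtain ⟨h0, h1, -⟩ := forms_nonneg_of_L_ne_top hn h
  obtain ⟨h2, h3, -⟩ := forms_nonneg_of_L_ne_top hn h'
  rw [forms_chiFun hn] at h2 h3
  exact rationalRatio_chi (by omega) ((mem_ChiDomain_iff p).2 ⟨h0, h1, h2, h3⟩)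

lemma rationalRatio_of_ne_top (hn : 3 ≤ n) {g : GLZ (Index n)}
    (hg : g ∈ group n (Nat.le_of_succ_le hn)) {p : Params n} (hp : L n p ≠ ∞)
    (hgp : L n (g p) ≠ ∞) : RationalRatio (L n (g p)) (L n p) := by
  rcases L_apply_mem_group hn hg with h | h | h | h
  · rw [h]
    exact .refl (L_pos _).ne'
  · rw [h] at hgp ⊢
    exact rationalRatio_chi_of_ne_top hn hp hgp
  · rw [h, ← psiFun_chiFun_psiFun hn, L_psi hn] at hgp ⊢
    -- The conjugate case is the `χ` case at the point `ψ(p)`.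
    rw [← L_psi hn p] at hp ⊢
    exact rationalRatio_chi_of_ne_top hn hp hgp
  -- Finiteness at `p` makes forms 0, 1, 4, 5 nonnegative, and finiteness at `g(p)` forms 2, 3, 6,
  -- 7; thus `p` is admissible.
  · refine (admissible_and_rationalRatio hn hg p).2 ((mem_Admissible_iff p).2 ?_)
    rw [h] at hgp
    obtain ⟨h0, h1, h4, h5⟩ := forms_nonneg_of_L_ne_top hn hp
    obtain ⟨h2, h3, h6, h7⟩ := forms_nonneg_of_L_ne_top hn hgp
    rw [forms_chiFun hn, ← psi_chi_psi_apply hn, forms_psi_chi_psi hn] at h2 h3 h6 h7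
    intro i
    fin_cases i
    exacts [h0, h1, h2, h3, h4, h5, h6, h7]

end RhinViola

theorem mainTheorem3 (n : ℕ) (hn : 3 ≤ n) :
    -- the invariance of `L` under `σ` and `ψ`, and the relation for `χ`
    (∀ p : Params n, L n (sigma n (Nat.le_of_succ_le hn) p) = L n p) ∧
    (∀ p : Params n, L n (psi n (Nat.le_of_succ_le hn) p) = L n p) ∧
    (∀ p ∈ ChiDomain n,
      L n p = (((cA p n).toNat.factorial * (cB p n).toNat.factorial : ℕ) : ℝ≥0∞) /
          (((cC p n).toNat.factorial * (cA p n + cB p n - cC p n).toNat.factorial : ℕ) : ℝ≥0∞) *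
        L n (chi n (Nat.le_of_succ_le hn) p)) ∧
    -- the group generated by `σ`, `ψ`, `χ`
    Nat.card (group n (Nat.le_of_succ_le hn)) = 32 ∧
    Nonempty (group n (Nat.le_of_succ_le hn) ≃*
      SemidirectProduct (Klein × Klein) (Multiplicative (ZMod 2)) swapAction) ∧
    -- it is a Rhin–Viola group, infinite values included, on the admissible parameters
    IsRhinViolaGroup (L n) (Admissible n) (group n (Nat.le_of_succ_le hn)) ∧
    -- for arbitrary parameters: positivity, and rationality of every quotient of finite values
    (∀ p : Params n, 0 < L n p) ∧
    (∀ g ∈ group n (Nat.le_of_succ_le hn), ∀ p : Params n, L n p ≠ ∞ → L n (g p) ≠ ∞ →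
      RationalRatio (L n (g p)) (L n p)) := by
  refine ⟨L_sigma (by omega), L_psi hn, fun p hp => L_chi (by omega) hp, card_group hn, ?_,
    ⟨fun p _ => L_pos p, fun g hg p hp => (admissible_and_rationalRatio hn hg p).1.2 hp,
      fun g hg p hp => (admissible_and_rationalRatio hn hg p).2 hp⟩, L_pos,
    fun g hg p hp hgp => rationalRatio_of_ne_top hn hg hp hgp⟩
  rw [← groupHom_range hn]
  exact ⟨((groupHom n hn).ofInjective (groupHom_injective hn)).symm⟩
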